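/- Let $K$ be an infinite field and let $S=K[x_1,\dots,x_n]$ be the polynomial ring with the standard grading, $\deg x_i=1$. Let $I,J\subset S$ be homogeneous ideals and let $w,w'\in\mathbb{Z}_{\ge 0}^n$. For a weight $w$, the initial form $\mathrm{in}_w(f)$ of $f\in S$ is the sum of those terms $c_a x^a$ of $f$ for which $a_1w_1+\cdots+a_nw_n$ is largest, and $\mathrm{in}_w(I)$ is the ideal generated by all $\mathrm{in}_w(f)$ with $f\in I$. A matrix $g=(g_{kl})\in \mathrm{GL}_n(K)$ acts on $S$ as the $K$-algebra automorphism with $g(x_i)=\sum_{l} g_{li}x_l$. For finitely generated graded $S$-modules $M$ and $N$, $\mathrm{Tor}_i(M,N)_j$ denotes the degree-$j$ component of the graded module $\mathrm{Tor}_i^S(M,N)$. Fix an integer $j$. Then there is a non-empty Zariski open subset $U\subset \mathrm{GL}_n(K)$ such that for every $g\in U$ and every $i\ge 0$: (i) $\dim_K \mathrm{Tor}_i(S/I,\,S/g(J))_j \le \dim_K \mathrm{Tor}_i(S/\mathrm{in}_w(I),\,S/\mathrm{in}_{w'}(J))_j$; (ii) $\dim_K \mathrm{Tor}_i(I,\,S/g(J))_j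 \le \dim_K \mathrm{Tor}_i(\mathrm{in}_w(I),\,S/\mathrm{in}_{w'}(J))_j$. -/

import Mathlib

open MvPolynomial Matrix TensorProduct

universe u

/-! ### The standard graded polynomial ring -/

/-- The standard grading of `K[x_1, …, x_n]`, indexed by `ℤ`: the piece of degree `d` consists of
the polynomials all of whose monomials have degree `d` (every variable has degree one). -/
noncomputable def stdGrading (K : Type u) [Field K] (n : ℕ) :
    ℤ → Submodule K (MvPolynomial (Fin n) K) :=
  fun d => weightedHomogeneousSubmodule K (fun _ : Fin n => (1 : ℤ)) d

noncomputable instance stdGrading.gradedAlgebra (K : Type u) [Field K] (n : ℕ) :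
    GradedAlgebra (stdGrading K n) :=
  weightedGradedAlgebra K (fun _ : Fin n => (1 : ℤ))

section Ring

variable {K : Type u} [Field K] {n : ℕ}

/-- The component of degree `d` of a polynomial, as a linear map. -/
noncomputable def stdComponent (K : Type u) [Field K] (n : ℕ) (d : ℤ) :
    MvPolynomial (Fin n) K →ₗ[K] MvPolynomial (Fin n) K :=
  weightedHomogeneousComponent (fun _ : Fin n => (1 : ℤ)) d

theorem stdComponent_mem (d : ℤ) (f : MvPolynomial (Fin n) K) :
    stdComponent K n d f ∈ stdGrading K n d :=
  weightedHomogeneousComponent_mem _ _ _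

theorem stdComponent_same {d : ℤ} {f : MvPolynomial (Fin n) K} (hf : f ∈ stdGrading K n d) :
    stdComponent K n d f = f :=
  weightedHomogeneousComponent_eq_self hf

theorem stdComponent_ne {d e : ℤ} (hde : d ≠ e) {f : MvPolynomial (Fin n) K}
    (hf : f ∈ stdGrading K n d) : stdComponent K n e f = 0 := by
  have := weightedHomogeneousComponent_of_mem (m := e) hf
  rw [if_neg hde.symm] at this
  exact this

theorem stdComponent_mem_ideal (I : HomogeneousIdeal (stdGrading K n)) (d : ℤ)
    {f : MvPolynomial (Fin n) K} (hf : f ∈ I.toIdeal) : stdComponent K n d f ∈ I.toIdeal := by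
  have h := I.isHomogeneous d hf
  have e : ((DirectSum.decompose (stdGrading K n) f d : stdGrading K n d) :
      MvPolynomial (Fin n) K) = stdComponent K n d f :=
    weightedDecomposition.decompose'_apply K (fun _ : Fin n => (1 : ℤ)) f d
  rwa [e] at h

theorem exists_sum_stdComponent (f : MvPolynomial (Fin n) K) :
    ∃ s : Finset ℤ, f = ∑ d ∈ s, stdComponent K n d f := by
  have h := weightedHomogeneousComponent_finsupp (w := fun _ : Fin n => (1 : ℤ)) f
  refine ⟨h.toFinset, ?_⟩
  conv_lhs => rw [← sum_weightedHomogeneousComponent (fun _ : Fin n => (1 : ℤ)) f]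
  exact finsum_eq_sum _ h

theorem stdGrading_mul {a b : ℤ} {f g : MvPolynomial (Fin n) K} (hf : f ∈ stdGrading K n a)
    (hg : g ∈ stdGrading K n b) : f * g ∈ stdGrading K n (a + b) :=
  IsWeightedHomogeneous.mul hf hg

end Ring

/-! ### Finitely generated graded modules -/

/-- A finitely generated `ℤ`-graded module over the standard graded ring `S = K[x_1, …, x_n]`. -/
structure FGGradedModule (K : Type u) [Field K] (n : ℕ) where
  carrier : Type u
  [addCommGroup : AddCommGroup carrier]
  [module : Module (MvPolynomial (Fin n) K) carrier]
  [moduleK : Module K carrier]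
  [isScalarTower : IsScalarTower K (MvPolynomial (Fin n) K) carrier]
  [finite : Module.Finite (MvPolynomial (Fin n) K) carrier]
  /-- the graded pieces -/
  part : ℤ → Submodule K carrier
  isInternal : DirectSum.IsInternal part
  smul_mem : ∀ {a b : ℤ} {f : MvPolynomial (Fin n) K} {m : carrier},
    f ∈ stdGrading K n a → m ∈ part b → f • m ∈ part (a + b)

namespace FGGradedModule

attribute [instance] addCommGroup module moduleK isScalarTower finite

/-- A criterion for a family of subspaces to be a grading. -/
theorem isInternal_of_proj {K : Type*} [Field K] {M : Type*} [AddCommGroup M] [Module K M]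
    (P : ℤ → Submodule K M) (π : ℤ → M →ₗ[K] M)
    (h1 : ∀ j, ∀ m ∈ P j, π j m = m) (h2 : ∀ i j, i ≠ j → ∀ m ∈ P i, π j m = 0)
    (h3 : ∀ m, m ∈ ⨆ j, P j) : DirectSum.IsInternal P := by
  refine DirectSum.isInternal_submodule_of_iSupIndep_of_iSup_eq_top ?_
    (eq_top_iff.2 fun m _ => h3 m)
  intro i
  rw [Submodule.disjoint_def]
  intro x hx hx'
  have hle : (⨆ j, ⨆ (_ : j ≠ i), P j) ≤ LinearMap.ker (π i) :=
    iSup_le fun j => iSup_le fun hj m hm => h2 j i hj m hm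
  rw [← h1 i x hx]
  exact hle hx'

variable {K : Type u} [Field K] {n : ℕ}

/-- The projection of a graded module to its piece of degree `j`. -/
noncomputable def proj (M : FGGradedModule K n) (j : ℤ) : M.carrier →ₗ[K] M.carrier :=
  (M.part j).subtype ∘ₗ DirectSum.component K ℤ (fun j => M.part j) j ∘ₗ
    (LinearEquiv.ofBijective (DirectSum.coeLinearMap M.part) M.isInternal).symm.toLinearMap

theorem proj_same (M : FGGradedModule K n) (j : ℤ) (m : M.carrier) (hm : m ∈ M.part j) :
    M.proj j m = m := by
  exact congrArg Subtype.val
    (M.isInternal.ofBijective_coeLinearMap_same (⟨m, hm⟩ : M.part j))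

theorem proj_ne (M : FGGradedModule K n) (i j : ℤ) (hij : i ≠ j) (m : M.carrier)
    (hm : m ∈ M.part i) : M.proj j m = 0 := by
  exact congrArg Subtype.val
    (M.isInternal.ofBijective_coeLinearMap_of_ne hij (⟨m, hm⟩ : M.part i))

theorem mem_iSup (M : FGGradedModule K n) (m : M.carrier) : m ∈ ⨆ j, M.part j := by
  rw [M.isInternal.submodule_iSup_eq_top]
  trivial

/-- The ring `S` as a graded module over itself. -/
@[reducible] noncomputable def self (K : Type u) [Field K] (n : ℕ) : FGGradedModule K n where
  carrier := MvPolynomial (Fin n) K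
  part := stdGrading K n
  isInternal := by
    refine isInternal_of_proj _ (stdComponent K n) (fun j m hm => stdComponent_same hm)
      (fun i j hij m hm => stdComponent_ne hij hm) fun f => ?_
    obtain ⟨s, hs⟩ := exists_sum_stdComponent f
    rw [hs]
    exact Submodule.sum_mem _ fun d _ => Submodule.mem_iSup_of_mem d (stdComponent_mem d f)
  smul_mem hf hm := stdGrading_mul hf hm

/-- A submodule is graded if it is the sum of its intersections with the graded pieces. -/
def IsGradedSubmodule (M : FGGradedModule K n)
    (N : Submodule (MvPolynomial (Fin n) K) M.carrier) : Prop :=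
  ∀ x ∈ N, x ∈ ⨆ j, (M.part j ⊓ N.restrictScalars K)

/-- A graded submodule `N ⊆ M`, with the pieces `N ∩ M_j`. -/
@[reducible] noncomputable def sub (M : FGGradedModule K n) (N : Submodule (MvPolynomial (Fin n) K) M.carrier)
    (hN : M.IsGradedSubmodule N) : FGGradedModule K n where
  carrier := N
  part j := (M.part j).comap (N.subtype.restrictScalars K)
  isInternal := by
    have hle : ∀ x ∈ N, ∀ j, M.proj j x ∈ N := by
      intro x hx j
      have : (⨆ j, (M.part j ⊓ N.restrictScalars K)) ≤
          (N.restrictScalars K).comap (M.proj j) := by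
        refine iSup_le fun i m hm => ?_
        by_cases hij : i = j
        · subst hij
          rw [Submodule.mem_comap, M.proj_same i m hm.1]
          exact hm.2
        · rw [Submodule.mem_comap, M.proj_ne i j hij m hm.1]
          exact zero_mem _
      exact this (hN x hx)
    refine isInternal_of_proj _
      (fun j => (M.proj j).restrict (p := N.restrictScalars K) (q := N.restrictScalars K)
        (fun x hx => hle x hx j)) ?_ ?_ ?_
    · intro j m hm
      exact Subtype.ext (M.proj_same j _ hm)
    · intro i j hij m hm
      exact Subtype.ext (M.proj_ne i j hij _ hm)
    · rintro ⟨x, hx⟩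
      have h := hN x hx
      have h2 : (⨆ j, (M.part j ⊓ N.restrictScalars K)) ≤
          (⨆ j, (M.part j).comap (N.subtype.restrictScalars K)).map
            (N.subtype.restrictScalars K) := by
        refine iSup_le fun i m hm => ⟨⟨m, hm.2⟩, ?_, rfl⟩
        exact Submodule.mem_iSup_of_mem i hm.1
      obtain ⟨y, hy, hyx⟩ := h2 h
      have : y = ⟨x, hx⟩ := Subtype.ext hyx
      rwa [← this]
  smul_mem hf hm := M.smul_mem hf hm

/-- The quotient `M / N` by a graded submodule; its pieces are the images of the `M_j`. -/
@[reducible] noncomputable def quot (M : FGGradedModule K n) (N : Submodule (MvPolynomial (Fin n) K) M.carrier)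
    (hN : M.IsGradedSubmodule N) : FGGradedModule K n where
  carrier := M.carrier ⧸ N
  part j := (M.part j).map (N.mkQ.restrictScalars K)
  isInternal := by
    have hle : ∀ j, N.restrictScalars K ≤ (N.restrictScalars K).comap (M.proj j) := by
      intro j x hx
      have : (⨆ j, (M.part j ⊓ N.restrictScalars K)) ≤
          (N.restrictScalars K).comap (M.proj j) := by
        refine iSup_le fun i m hm => ?_
        by_cases hij : i = j
        · subst hij
          rw [Submodule.mem_comap, M.proj_same i m hm.1]
          exact hm.2
        · rw [Submodule.mem_comap, M.proj_ne i j hij m hm.1]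
          exact zero_mem _
      exact this (hN x hx)
    refine isInternal_of_proj _
      (fun j => (N.restrictScalars K).mapQ (N.restrictScalars K) (M.proj j) (hle j)) ?_ ?_ ?_
    · rintro j _ ⟨m, hm, rfl⟩
      exact congrArg N.mkQ (M.proj_same j m hm)
    · rintro i j hij _ ⟨m, hm, rfl⟩
      exact (congrArg N.mkQ (M.proj_ne i j hij m hm)).trans (map_zero _)
    · intro x
      obtain ⟨m, rfl⟩ := N.mkQ_surjective x
      have h := Submodule.mem_map_of_mem (f := N.mkQ.restrictScalars K) (M.mem_iSup m)
      rw [Submodule.map_iSup] at h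
      exact h
  smul_mem := by
    rintro a b f _ hf ⟨m, hm, rfl⟩
    exact ⟨f • m, M.smul_mem hf hm, map_smul N.mkQ f m⟩

theorem isGradedSubmodule_ideal (I : HomogeneousIdeal (stdGrading K n)) :
    (self K n).IsGradedSubmodule I.toIdeal := by
  intro (f : MvPolynomial (Fin n) K) hf
  obtain ⟨s, hs⟩ := exists_sum_stdComponent f
  rw [hs]
  exact Submodule.sum_mem _ fun d _ =>
    Submodule.mem_iSup_of_mem d ⟨stdComponent_mem d f, stdComponent_mem_ideal I d hf⟩

/-- A homogeneous ideal `I`, as a graded module with the pieces `I ∩ S_j`. -/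
@[reducible] noncomputable def ofIdeal (I : HomogeneousIdeal (stdGrading K n)) : FGGradedModule K n :=
  (self K n).sub I.toIdeal (isGradedSubmodule_ideal I)

/-- The graded module `S / I` for a homogeneous ideal `I`. -/
@[reducible] noncomputable def ofQuotient (I : HomogeneousIdeal (stdGrading K n)) : FGGradedModule K n :=
  (self K n).quot I.toIdeal (isGradedSubmodule_ideal I)

/-- The graded free module `⨁ k, S(-a k)`: its `k`-th basis vector has degree `a k`, and its
piece of degree `j` is `⨁ k, S_(j - a k)`. -/
@[reducible] noncomputable def free {r : ℕ} (a : Fin r → ℤ) : FGGradedModule K n where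
  carrier := Fin r → MvPolynomial (Fin n) K
  part j := Submodule.pi Set.univ fun k => stdGrading K n (j - a k)
  isInternal := by
    refine isInternal_of_proj _
      (fun j => LinearMap.pi fun k => stdComponent K n (j - a k) ∘ₗ LinearMap.proj k) ?_ ?_ ?_
    · intro j m hm
      funext k
      exact stdComponent_same (hm k trivial)
    · intro i j hij m hm
      funext k
      exact stdComponent_ne (fun h => hij (by linarith)) (hm k trivial)
    · intro f
      rw [← Finset.univ_sum_single f]
      refine Submodule.sum_mem _ fun k _ => ?_
      obtain ⟨s, hs⟩ := exists_sum_stdComponent (f k)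
      rw [hs]
      have : (Pi.single k (∑ d ∈ s, stdComponent K n d (f k)) :
          Fin r → MvPolynomial (Fin n) K) =
          ∑ d ∈ s, Pi.single k (stdComponent K n d (f k)) :=
        map_sum (LinearMap.single K (fun _ : Fin r => MvPolynomial (Fin n) K) k) _ s
      rw [this]
      refine Submodule.sum_mem _ fun d _ => Submodule.mem_iSup_of_mem (d + a k) fun l _ => ?_
      by_cases hl : l = k
      · subst hl
        have := stdComponent_mem (K := K) (n := n) d (f l)
        simpa using this
      · rw [Pi.single_eq_of_ne hl]
        exact zero_mem _
  smul_mem := by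
    intro a' b f m hf hm k _
    have := stdGrading_mul hf (hm k trivial)
    rwa [← add_sub_assoc] at this

/-- An `S`-linear map of graded modules is homogeneous (of degree zero) if it preserves
degrees. -/
def IsGradedHom (M N : FGGradedModule K n)
    (φ : M.carrier →ₗ[MvPolynomial (Fin n) K] N.carrier) : Prop :=
  ∀ j, ∀ x ∈ M.part j, φ x ∈ N.part j

theorem isGradedSubmodule_ker (M N : FGGradedModule K n)
    (φ : M.carrier →ₗ[MvPolynomial (Fin n) K] N.carrier) (hφ : M.IsGradedHom N φ) :
    M.IsGradedSubmodule (LinearMap.ker φ) := by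
  intro x hx
  have hcomm : ∀ j y, φ (M.proj j y) = N.proj j (φ y) := by
    intro j y
    have hle : (⨆ i, M.part i) ≤ LinearMap.eqLocus (φ.restrictScalars K ∘ₗ M.proj j)
        (N.proj j ∘ₗ φ.restrictScalars K) := by
      refine iSup_le fun i m hm => ?_
      change φ (M.proj j m) = N.proj j (φ m)
      by_cases hij : i = j
      · subst hij
        rw [M.proj_same i m hm, N.proj_same i _ (hφ i m hm)]
      · rw [M.proj_ne i j hij m hm, N.proj_ne i j hij _ (hφ i m hm), map_zero]
    exact hle (M.mem_iSup y)
  obtain ⟨c, hc⟩ := M.isInternal.2 x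
  have hproj : ∀ j, M.proj j x = c j := by
    intro j
    subst hc
    have : (LinearEquiv.ofBijective (DirectSum.coeLinearMap M.part) M.isInternal).symm
        (DirectSum.coeAddMonoidHom M.part c) = c := by
      rw [LinearEquiv.symm_apply_eq]
      rfl
    change ((LinearEquiv.ofBijective (DirectSum.coeLinearMap M.part) M.isInternal).symm
        (DirectSum.coeAddMonoidHom M.part c) j : M.carrier) = _
    rw [this]
  classical
  have hx' : x = ∑ j ∈ c.support, (c j : M.carrier) := by
    rw [← hc]
    exact DirectSum.coeAddMonoidHom_eq_dfinsuppSum _ c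
  rw [hx']
  refine Submodule.sum_mem _ fun j _ => Submodule.mem_iSup_of_mem j ⟨(c j).2, ?_⟩
  change φ (c j) = 0
  rw [← hproj, hcomm, LinearMap.mem_ker.1 hx, map_zero]

/-- Every finitely generated graded module is the image of a graded free module of finite rank
under a homogeneous map. -/
theorem exists_cover (M : FGGradedModule K n) :
    ∃ (r : ℕ) (a : Fin r → ℤ)
      (φ : (Fin r → MvPolynomial (Fin n) K) →ₗ[MvPolynomial (Fin n) K] M.carrier),
      (free a).IsGradedHom M φ ∧ Function.Surjective φ := by
  have hspan : Submodule.span (MvPolynomial (Fin n) K) {m | ∃ j, m ∈ M.part j} = ⊤ := by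
    rw [eq_top_iff]
    intro m _
    have hle : (⨆ j, M.part j) ≤
        (Submodule.span (MvPolynomial (Fin n) K) {m | ∃ j, m ∈ M.part j}).restrictScalars K :=
      iSup_le fun j m hm => Submodule.subset_span ⟨j, hm⟩
    exact hle (M.mem_iSup m)
  have hfg : (⊤ : Submodule (MvPolynomial (Fin n) K) M.carrier).FG := Module.Finite.fg_top
  rw [← hspan, Submodule.fg_span_iff_fg_span_finset_subset] at hfg
  obtain ⟨s, hs, hs'⟩ := hfg
  rw [hspan] at hs'
  choose a ha using fun k : Fin s.card => hs (s.equivFin.symm k).2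
  refine ⟨s.card, a, Fintype.linearCombination (MvPolynomial (Fin n) K)
    (fun k => (s.equivFin.symm k : M.carrier)), ?_, ?_⟩
  · intro j x hx
    change ∑ k, x k • (s.equivFin.symm k : M.carrier) ∈ M.part j
    refine Submodule.sum_mem _ fun k _ => ?_
    have := M.smul_mem (hx k trivial) (ha k)
    rwa [sub_add_cancel] at this
  · refine LinearMap.range_eq_top.1 ?_
    refine (Fintype.range_linearCombination (MvPolynomial (Fin n) K) _).trans ?_
    rw [hs']
    congr 1
    ext m
    constructor
    · rintro ⟨k, rfl⟩
      exact (s.equivFin.symm k).2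
    · intro hm
      exact ⟨s.equivFin ⟨m, hm⟩, by simp⟩

end FGGradedModule

/-! ### Graded free resolutions and graded `Tor` -/

/-- A graded free resolution `⋯ → F_2 → F_1 → F_0 → M → 0` with `F_p = ⨁ k, S(-shift p k)` of
finite rank and homogeneous maps. -/
structure GradedFreeResolution {K : Type u} [Field K] {n : ℕ} (M : FGGradedModule K n) where
  rank : ℕ → ℕ
  shift : ∀ p, Fin (rank p) → ℤ
  d : ∀ p, (Fin (rank (p + 1)) → MvPolynomial (Fin n) K) →ₗ[MvPolynomial (Fin n) K]
    (Fin (rank p) → MvPolynomial (Fin n) K)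
  aug : (Fin (rank 0) → MvPolynomial (Fin n) K) →ₗ[MvPolynomial (Fin n) K] M.carrier
  d_graded : ∀ p, (FGGradedModule.free (shift (p + 1))).IsGradedHom
    (FGGradedModule.free (shift p)) (d p)
  aug_graded : (FGGradedModule.free (shift 0)).IsGradedHom M aug
  aug_surjective : Function.Surjective aug
  exact_zero : Function.Exact (d 0) aug
  exact_succ : ∀ p, Function.Exact (d (p + 1)) (d p)

namespace GradedFreeResolution

variable {K : Type u} [Field K] {n : ℕ}

section Existence

open FGGradedModule

/-- The rank of a chosen free cover of `M`. -/
noncomputable def coverRank (M : FGGradedModule K n) : ℕ := M.exists_cover.choose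

/-- The degrees of the basis vectors of a chosen free cover of `M`. -/
noncomputable def coverShift (M : FGGradedModule K n) : Fin (coverRank M) → ℤ :=
  M.exists_cover.choose_spec.choose

/-- A chosen free cover of `M`. -/
noncomputable def coverMap (M : FGGradedModule K n) :
    (Fin (coverRank M) → MvPolynomial (Fin n) K) →ₗ[MvPolynomial (Fin n) K] M.carrier :=
  M.exists_cover.choose_spec.choose_spec.choose

theorem coverMap_graded (M : FGGradedModule K n) :
    (free (coverShift M)).IsGradedHom M (coverMap M) :=
  M.exists_cover.choose_spec.choose_spec.choose_spec.1

theorem coverMap_surjective (M : FGGradedModule K n) : Function.Surjective (coverMap M) :=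
  M.exists_cover.choose_spec.choose_spec.choose_spec.2

/-- The kernel of the chosen free cover of `M`. -/
@[reducible] noncomputable def syz (M : FGGradedModule K n) : FGGradedModule K n :=
  (free (coverShift M)).sub (LinearMap.ker (coverMap M))
    (isGradedSubmodule_ker _ _ _ (coverMap_graded M))

/-- The map from the chosen free cover of the kernel to the chosen free cover of `M`. -/
noncomputable def syzMap (M : FGGradedModule K n) :
    (Fin (coverRank (syz M)) → MvPolynomial (Fin n) K) →ₗ[MvPolynomial (Fin n) K]
      (Fin (coverRank M) → MvPolynomial (Fin n) K) :=
  (LinearMap.ker (coverMap M)).subtype ∘ₗ coverMap (syz M)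

theorem syzMap_exact (M : FGGradedModule K n) : Function.Exact (syzMap M) (coverMap M) := by
  intro y
  constructor
  · intro hy
    obtain ⟨x, hx⟩ := coverMap_surjective (syz M) ⟨y, hy⟩
    exact ⟨x, congrArg Subtype.val hx⟩
  · rintro ⟨x, rfl⟩
    exact (coverMap (syz M) x).2

theorem syzMap_exact' (M : FGGradedModule K n) :
    Function.Exact (syzMap (syz M)) (syzMap M) := by
  intro y
  refine Iff.trans ⟨fun h => Subtype.ext h, fun h => congrArg Subtype.val h⟩
    (syzMap_exact (syz M) y)

/-- The iterated kernels of chosen free covers. -/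
noncomputable def iterSyz (M : FGGradedModule K n) (p : ℕ) : FGGradedModule K n :=
  Nat.rec M (fun _ N => syz N) p

/-- Every finitely generated graded module has a graded free resolution. -/
theorem nonempty (M : FGGradedModule K n) : Nonempty (GradedFreeResolution M) :=
  ⟨{ rank := fun p => coverRank (iterSyz M p)
     shift := fun p => coverShift (iterSyz M p)
     d := fun p => syzMap (iterSyz M p)
     aug := coverMap M
     d_graded := fun p j x hx => coverMap_graded (iterSyz M (p + 1)) j x hx
     aug_graded := coverMap_graded M
     aug_surjective := coverMap_surjective M
     exact_zero := syzMap_exact M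
     exact_succ := fun p => syzMap_exact' (iterSyz M p) }⟩

end Existence

variable {M : FGGradedModule K n} (F : GradedFreeResolution M) (N : FGGradedModule K n)

/-- The module `F_p ⊗_S N`. -/
abbrev tensor (p : ℕ) : Type u :=
  (Fin (F.rank p) → MvPolynomial (Fin n) K) ⊗[MvPolynomial (Fin n) K] N.carrier

/-- The piece of degree `j` of `F_p ⊗_S N`: the span of the `x ⊗ y` with `x` homogeneous of
degree `a`, `y` homogeneous of degree `b`, and `a + b = j`. -/
noncomputable def tensorPart (p : ℕ) (j : ℤ) : Submodule K (F.tensor N p) :=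
  Submodule.span K {t | ∃ (a b : ℤ) (x : Fin (F.rank p) → MvPolynomial (Fin n) K)
    (y : N.carrier), x ∈ (FGGradedModule.free (F.shift p)).part a ∧ y ∈ N.part b ∧
      a + b = j ∧ t = x ⊗ₜ y}

/-- The cycles of the complex `F ⊗_S N`; in homological degree `0` everything is a cycle. -/
noncomputable def cycles : ∀ i : ℕ, Submodule (MvPolynomial (Fin n) K) (F.tensor N i)
  | 0 => ⊤
  | p + 1 => LinearMap.ker ((F.d p).rTensor N.carrier)

/-- The boundaries of the complex `F ⊗_S N`. -/
noncomputable def boundaries (i : ℕ) : Submodule (MvPolynomial (Fin n) K) (F.tensor N i) :=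
  LinearMap.range ((F.d i).rTensor N.carrier)

/-- `Tor_i(M, N) = H_i(F ⊗_S N)`, computed from the graded free resolution `F` of `M`: the cycles
modulo the boundaries, inside `F_i ⊗_S N` modulo the boundaries. -/
noncomputable def tor (i : ℕ) :
    Submodule (MvPolynomial (Fin n) K) (F.tensor N i ⧸ F.boundaries N i) :=
  (F.cycles N i).map (F.boundaries N i).mkQ

/-- The graded piece `Tor_i(M, N)_j`: the classes of the cycles of degree `j`. -/
noncomputable def torPart (i : ℕ) (j : ℤ) :
    Submodule K (F.tensor N i ⧸ F.boundaries N i) :=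
  (F.tensorPart N i j ⊓ (F.cycles N i).restrictScalars K).map
    ((F.boundaries N i).mkQ.restrictScalars K)

end GradedFreeResolution

/-- `dim_K Tor_i(M, N)_j`, as a cardinal, where `Tor` is computed from some graded free resolution
of `M` of finite rank in each homological degree; one exists by `GradedFreeResolution.nonempty`,
and, as always for `Tor`, the result does not depend on which one is taken. -/
noncomputable def torDim {K : Type u} [Field K] {n : ℕ} (M N : FGGradedModule K n) (i : ℕ)
    (j : ℤ) : Cardinal.{u} :=
  Module.rank K ((Classical.choice (GradedFreeResolution.nonempty M)).torPart N i j)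

/-! ### Initial ideals with respect to a weight -/

section Initial

variable {K : Type u} [Field K] {n : ℕ}

/-- The initial form of `f` with respect to the weight `w`: the sum of the terms `c_a x^a` of `f`
for which `a_1 w_1 + ⋯ + a_n w_n` is largest. -/
noncomputable def initialForm (w : Fin n → ℕ) (f : MvPolynomial (Fin n) K) :
    MvPolynomial (Fin n) K :=
  weightedHomogeneousComponent w (weightedTotalDegree w f) f

theorem initialForm_mem_stdGrading (w : Fin n → ℕ) {d : ℤ} {f : MvPolynomial (Fin n) K}
    (hf : f ∈ stdGrading K n d) : initialForm w f ∈ stdGrading K n d := by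
  classical
  intro m hm
  refine hf fun h => hm ?_
  rw [initialForm, coeff_weightedHomogeneousComponent, h, ite_self]

theorem initialIdeal_aux (I : HomogeneousIdeal (stdGrading K n)) (w : Fin n → ℕ) :
    (Ideal.span (initialForm w '' (I.toIdeal : Set (MvPolynomial (Fin n) K)))).IsHomogeneous
      (stdGrading K n) := by
  classical
  have key : Ideal.span (initialForm w '' (I.toIdeal : Set (MvPolynomial (Fin n) K))) =
      Ideal.span (initialForm w ''
        {f | f ∈ I.toIdeal ∧ SetLike.IsHomogeneousElem (stdGrading K n) f}) := by
    refine le_antisymm (Ideal.span_le.2 ?_) (Ideal.span_mono (Set.image_mono fun f hf => hf.1))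
    rintro _ ⟨f, hf, rfl⟩
    obtain ⟨s, hs⟩ := exists_sum_stdComponent f
    have h1 : initialForm w f = ∑ d ∈ s,
        weightedHomogeneousComponent w (weightedTotalDegree w f) (stdComponent K n d f) := by
      rw [initialForm, ← map_sum, ← hs]
    rw [h1]
    refine Ideal.sum_mem _ fun d _ => ?_
    by_cases h0 : weightedHomogeneousComponent w (weightedTotalDegree w f)
        (stdComponent K n d f) = 0
    · rw [h0]
      exact zero_mem _
    · have hwt : weightedTotalDegree w (stdComponent K n d f) = weightedTotalDegree w f := by
        apply le_antisymm
        · refine Finset.sup_le fun m hm => le_weightedTotalDegree w ?_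
          rw [mem_support_iff] at hm ⊢
          intro h
          apply hm
          rw [stdComponent, coeff_weightedHomogeneousComponent, h, ite_self]
        · by_contra hlt
          exact h0 (weightedHomogeneousComponent_eq_zero _ _ (not_le.1 hlt))
      refine Ideal.subset_span ⟨stdComponent K n d f,
        ⟨stdComponent_mem_ideal I d hf, ⟨d, stdComponent_mem d f⟩⟩, ?_⟩
      rw [initialForm, hwt]
  rw [key]
  apply Ideal.homogeneous_span
  rintro _ ⟨f, ⟨_, d, hd⟩, rfl⟩
  exact ⟨d, initialForm_mem_stdGrading w hd⟩

/-- The initial ideal `in_w(I)`, generated by the initial forms of all elements of `I`. -/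
noncomputable def initialIdeal (w : Fin n → ℕ) (I : HomogeneousIdeal (stdGrading K n)) :
    HomogeneousIdeal (stdGrading K n) where
  toSubmodule := Ideal.span (initialForm w '' (I.toIdeal : Set (MvPolynomial (Fin n) K)))
  is_homogeneous' := initialIdeal_aux I w

end Initial

/-! ### General changes of coordinates -/

section General

variable {K : Type u} [Field K] {n : ℕ}

/-- The change of coordinates `x_i ↦ ∑ l, g_(l i) x_l` defined by `g ∈ GL_n(K)`. -/
noncomputable def coordChange (g : GL (Fin n) K) :
    MvPolynomial (Fin n) K →ₐ[K] MvPolynomial (Fin n) K :=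
  aeval fun i => ∑ l, C ((g : Matrix (Fin n) (Fin n) K) l i) * X l

theorem coordChange_mem (g : GL (Fin n) K) {d : ℤ} {f : MvPolynomial (Fin n) K}
    (hf : f ∈ stdGrading K n d) : coordChange g f ∈ stdGrading K n d := by
  have hX : ∀ i, (∑ l, C ((g : Matrix (Fin n) (Fin n) K) l i) * X l) ∈ stdGrading K n 1 := by
    intro i
    refine Submodule.sum_mem _ fun l _ => ?_
    exact (isWeightedHomogeneous_X K (fun _ : Fin n => (1 : ℤ)) l).C_mul _
  rw [coordChange, aeval_def, eval₂_eq]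
  refine Submodule.sum_mem _ fun m hm => ?_
  have hd := hf (mem_support_iff.1 hm)
  have hp : IsWeightedHomogeneous (fun _ : Fin n => (1 : ℤ))
      (∏ i ∈ m.support, (∑ l, C ((g : Matrix (Fin n) (Fin n) K) l i) * X l) ^ m i)
      (∑ i ∈ m.support, m i • (1 : ℤ)) :=
    IsWeightedHomogeneous.prod _ _ _ fun i _ => IsWeightedHomogeneous.pow (hX i) _
  have hd' : (∑ i ∈ m.support, m i • (1 : ℤ)) = d := by
    rw [← hd, Finsupp.weight_apply]
    rfl
  rw [hd'] at hp
  exact hp.C_mul _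

/-- The ideal `g(J)`. -/
noncomputable def changeIdeal (g : GL (Fin n) K) (J : HomogeneousIdeal (stdGrading K n)) :
    HomogeneousIdeal (stdGrading K n) :=
  J.map (⟨(coordChange g).toRingHom, fun h => coordChange_mem g h⟩ :
    GradedRingHom (stdGrading K n) (stdGrading K n))

/-- `U ⊆ GL_n(K)` is Zariski open: its complement is the common zero locus in `GL_n(K)` of a set
of polynomials in the matrix entries. -/
def IsZariskiOpenGL (U : Set (GL (Fin n) K)) : Prop :=
  ∃ P : Set (MvPolynomial (Fin n × Fin n) K),
    Uᶜ = {g : GL (Fin n) K | ∀ p ∈ P,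
      eval (fun q : Fin n × Fin n => (g : Matrix (Fin n) (Fin n) K) q.1 q.2) p = 0}

/-- A property holds for a general `g ∈ GL_n(K)` if it holds on a non-empty Zariski open set. -/
def ForGeneralGL (Q : GL (Fin n) K → Prop) : Prop :=
  ∃ U : Set (GL (Fin n) K), U.Nonempty ∧ IsZariskiOpenGL U ∧ ∀ g ∈ U, Q g

end General

/-! The theorem is semicontinuity of `Tor`, applied to one argument at a time. For a fixed graded
free resolution F of M, Tor_i(M, N)_j is the homology of the degree-j strand of F ⊗ N, a complex of
finite-dimensional spaces. Let N be S/J_x or J_x, where the ideals J_x have constant Hilbert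
function and every homogeneous element of J_{x₀} extends to elements of J_x with coordinates in a
given algebra of functions of x, in practice polynomials (`IsFlatFamily`). Then the terms of the
strand have constant dimension. The ranks of its differentials do not drop wherever a suitable
function, nonzero at x₀, does not vanish. So the homology does not grow there
(`IsFlatFamily.exists_torDim_le`).

Two families are used: the torus translates of I, which degenerate to in_w(I) at t = 0
(`isFlatFamily_degeneration`), and g ↦ g(J) on GL_n (`isFlatFamily_changeIdeal`).

As K is infinite, the first family yields a diagonal h such that replacing in_{w'}(J) by h(J) does
not increase Tor against S/in_w(I) or in_w(I). It then yields a diagonal h' such that replacing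
in_w(I) by h'(I) does not increase Tor against S/h(J). Applying h'⁻¹ to both arguments preserves
dimensions (`torDim_twist`), so both inequalities hold at the single point g₀ = h'⁻¹h. The second
family, based at g₀, spreads them to a Zariski open neighbourhood.

Two facts about Tor are needed. Balancing, proved with the double complex F ⊗ G, gives independence
of the resolution (`torDim_eq`) and lets either argument vary (`torDim_comm`). Vanishing for i > j
(`torDim_eq_zero`) leaves finitely many i, so a finite product of functions defines one open set
valid for all i. -/

/-! ### Linear algebra -/

section LinearAlgebra

variable {K : Type u} [Field K]

/-- A linear relation between `Z` and `Z'` which is total on both sides and matches the kernels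
of `f` and `g` identifies the images of `Z` and `Z'`. -/
theorem rank_map_eq_of_relation {X Y A A' : Type u} [AddCommGroup X] [Module K X]
    [AddCommGroup Y] [Module K Y] [AddCommGroup A] [Module K A] [AddCommGroup A'] [Module K A']
    (f : X →ₗ[K] A) (g : Y →ₗ[K] A') (Z : Submodule K X) (Z' : Submodule K Y)
    (R : Submodule K (X × Y))
    (h1 : ∀ x ∈ Z, ∃ y ∈ Z', (x, y) ∈ R) (h2 : ∀ y ∈ Z', ∃ x ∈ Z, (x, y) ∈ R)
    (h3 : ∀ x ∈ Z, ∀ y ∈ Z', (x, y) ∈ R → (f x = 0 ↔ g y = 0)) :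
    Module.rank K (Z.map f) = Module.rank K (Z'.map g) := by
  -- Both images are quotients of this restricted relation, and `h3` says that the two kernels
  -- coincide. Neither direction has to be a function.
  let R' : Submodule K (X × Y) := R ⊓ Z.prod Z'
  let f' : R' →ₗ[K] A := f ∘ₗ LinearMap.fst K X Y ∘ₗ R'.subtype
  let g' : R' →ₗ[K] A' := g ∘ₗ LinearMap.snd K X Y ∘ₗ R'.subtype
  have hf : LinearMap.range f' = Z.map f := by
    ext a
    constructor
    · rintro ⟨⟨⟨x, y⟩, hxy⟩, rfl⟩
      exact ⟨x, hxy.2.1, rfl⟩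
    · rintro ⟨x, hx, rfl⟩
      obtain ⟨y, hy, hxy⟩ := h1 x hx
      exact ⟨⟨(x, y), hxy, hx, hy⟩, rfl⟩
  have hg : LinearMap.range g' = Z'.map g := by
    ext a
    constructor
    · rintro ⟨⟨⟨x, y⟩, hxy⟩, rfl⟩
      exact ⟨y, hxy.2.2, rfl⟩
    · rintro ⟨y, hy, rfl⟩
      obtain ⟨x, hx, hxy⟩ := h2 y hy
      exact ⟨⟨(x, y), hxy, hx, hy⟩, rfl⟩
  have hk : LinearMap.ker f' = LinearMap.ker g' := by
    ext ⟨⟨x, y⟩, hxy⟩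
    exact h3 x hxy.2.1 y hxy.2.2 hxy.1
  rw [← hf, ← hg, ← (f'.quotKerEquivRange).rank_eq, ← (g'.quotKerEquivRange).rank_eq, hk]

end LinearAlgebra

/-! ### Homology of complexes of vector spaces -/

section Complexes

variable {K : Type u} [Field K] {X : ℕ → Type u} [∀ i, AddCommGroup (X i)] [∀ i, Module K (X i)]

/-- The cycles of a sequence of linear maps; in degree `0` everything is a cycle. -/
def seqCycles (δ : ∀ i, X (i + 1) →ₗ[K] X i) : ∀ i, Submodule K (X i)
  | 0 => ⊤
  | p + 1 => LinearMap.ker (δ p)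

/-- The dimension of the `i`-th homology of a sequence of linear maps. -/
noncomputable def seqHomologyRank (δ : ∀ i, X (i + 1) →ₗ[K] X i) (i : ℕ) : Cardinal.{u} :=
  Module.rank K ((seqCycles δ i).map (LinearMap.range (δ i)).mkQ)

/-- The rank of the map from `X i` to `X (i - 1)`, zero for `i = 0`. -/
noncomputable def seqOutRank (δ : ∀ i, X (i + 1) →ₗ[K] X i) : ℕ → ℕ
  | 0 => 0
  | p + 1 => Module.finrank K (LinearMap.range (δ p))

theorem finrank_seqCycles_add [∀ i, FiniteDimensional K (X i)]
    (δ : ∀ i, X (i + 1) →ₗ[K] X i) (i : ℕ) :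
    Module.finrank K (seqCycles δ i) + seqOutRank δ i = Module.finrank K (X i) := by
  cases i with
  | zero => exact finrank_top K (X 0)
  | succ p =>
    rw [add_comm]
    exact LinearMap.finrank_range_add_finrank_ker (δ p)

/-- Rank-nullity, applied to the outgoing map and to the projection of the cycles modulo boundaries.
The additive form in ℕ exhibits homology as what is left of the term once both adjacent ranks are
removed, so larger ranks force smaller homology. -/
theorem exists_seqHomologyRank_eq [∀ i, FiniteDimensional K (X i)]
    (δ : ∀ i, X (i + 1) →ₗ[K] X i) (hδ : ∀ i x, δ i (δ (i + 1) x) = 0) (i : ℕ) :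
    ∃ h : ℕ, seqHomologyRank δ i = h ∧
      h + seqOutRank δ i + Module.finrank K (LinearMap.range (δ i)) =
        Module.finrank K (X i) := by
  have hle : LinearMap.range (δ i) ≤ seqCycles δ i := by
    cases i with
    | zero => exact le_top
    | succ p =>
      rintro _ ⟨x, rfl⟩
      exact hδ p x
  refine ⟨Module.finrank K ((seqCycles δ i).map (LinearMap.range (δ i)).mkQ),
    (Module.finrank_eq_rank _ _).symm, ?_⟩
  have h1 := LinearMap.finrank_range_add_finrank_ker
    ((LinearMap.range (δ i)).mkQ ∘ₗ (seqCycles δ i).subtype)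
  have h2 : LinearMap.range ((LinearMap.range (δ i)).mkQ ∘ₗ (seqCycles δ i).subtype) =
      (seqCycles δ i).map (LinearMap.range (δ i)).mkQ := by
    rw [LinearMap.range_comp, Submodule.range_subtype]
  have h3 : LinearMap.ker ((LinearMap.range (δ i)).mkQ ∘ₗ (seqCycles δ i).subtype) =
      (LinearMap.range (δ i)).comap (seqCycles δ i).subtype := by
    rw [LinearMap.ker_comp, Submodule.ker_mkQ]
  rw [h2, h3, (Submodule.comapSubtypeEquivOfLe hle).finrank_eq] at h1
  have h4 := finrank_seqCycles_add δ i
  omega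

/-- Of two complexes of finite-dimensional spaces of equal dimensions, the one with the
larger ranks has the smaller homology. -/
theorem seqHomologyRank_le_of_finrank [∀ i, FiniteDimensional K (X i)]
    {X' : ℕ → Type u} [∀ i, AddCommGroup (X' i)] [∀ i, Module K (X' i)]
    [∀ i, FiniteDimensional K (X' i)]
    (δ : ∀ i, X (i + 1) →ₗ[K] X i) (hδ : ∀ i x, δ i (δ (i + 1) x) = 0)
    (δ' : ∀ i, X' (i + 1) →ₗ[K] X' i) (hδ' : ∀ i x, δ' i (δ' (i + 1) x) = 0) (i : ℕ)
    (hX : Module.finrank K (X i) = Module.finrank K (X' i))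
    (hr : ∀ p ≤ i, Module.finrank K (LinearMap.range (δ' p)) ≤
      Module.finrank K (LinearMap.range (δ p))) :
    seqHomologyRank δ i ≤ seqHomologyRank δ' i := by
  obtain ⟨h, e, he⟩ := exists_seqHomologyRank_eq δ hδ i
  obtain ⟨h', e', he'⟩ := exists_seqHomologyRank_eq δ' hδ' i
  rw [e, e', Nat.cast_le]
  have h1 := hr i le_rfl
  have h2 : seqOutRank δ' i ≤ seqOutRank δ i := by
    cases i with
    | zero => exact le_rfl
    | succ p => exact hr p p.le_succ
  omega

theorem seqHomologyRank_congr {X' : ℕ → Type u} [∀ i, AddCommGroup (X' i)] [∀ i, Module K (X' i)]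
    (δ : ∀ i, X (i + 1) →ₗ[K] X i) (δ' : ∀ i, X' (i + 1) →ₗ[K] X' i)
    (ψ : ∀ i, X i ≃ₗ[K] X' i) (h : ∀ i x, ψ i (δ i x) = δ' i (ψ (i + 1) x)) (i : ℕ) :
    seqHomologyRank δ i = seqHomologyRank δ' i := by
  have hc : ∀ x, x ∈ seqCycles δ i ↔ ψ i x ∈ seqCycles δ' i := by
    intro x
    cases i with
    | zero => exact Iff.rfl
    | succ p =>
      change δ p x = 0 ↔ δ' p (ψ (p + 1) x) = 0
      rw [← h, LinearEquiv.map_eq_zero_iff]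
  refine rank_map_eq_of_relation _ _ _ _ (LinearMap.graph (ψ i).toLinearMap)
    (fun x hx => ⟨ψ i x, (hc x).1 hx, rfl⟩)
    (fun y hy => ⟨(ψ i).symm y, (hc _).2 (by simpa using hy), by simp [LinearMap.mem_graph_iff]⟩) ?_
  rintro x _ y _ (rfl : y = ψ i x)
  simp only [Submodule.mkQ_apply, Submodule.Quotient.mk_eq_zero, LinearMap.mem_range]
  constructor
  · rintro ⟨z, rfl⟩
    exact ⟨ψ (i + 1) z, (h i z).symm⟩
  · rintro ⟨z, hz⟩
    exact ⟨(ψ (i + 1)).symm z, (ψ i).injective (by rw [h]; simpa using hz)⟩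

theorem seqHomologyRank_eq_zero (δ : ∀ i, X (i + 1) →ₗ[K] X i) (i : ℕ) [Subsingleton (X i)] :
    seqHomologyRank δ i = 0 := by
  have : Subsingleton ((seqCycles δ i).map (LinearMap.range (δ i)).mkQ) := by
    refine ⟨?_⟩
    rintro ⟨_, x, _, rfl⟩ ⟨_, y, _, rfl⟩
    exact Subtype.ext (congrArg (LinearMap.range (δ i)).mkQ (Subsingleton.elim x y))
  exact rank_subsingleton' _ _

end Complexes

/-! ### Double complexes with exact rows and columns -/

section DoubleComplex

variable {K : Type u} [Field K] {X : ℕ → ℕ → Type u} [∀ p q, AddCommGroup (X p q)]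
  [∀ p q, Module K (X p q)] (d : ∀ p q, X (p + 1) q →ₗ[K] X p q)
  (e : ∀ p q, X p (q + 1) →ₗ[K] X p q)

/-- The elements whose horizontal boundary is a vertical boundary. -/
def horizontalCycles : ∀ p q, Submodule K (X p q)
  | 0, _ => ⊤
  | p + 1, q => (LinearMap.range (e p q)).comap (d p q)

/-- The elements whose vertical boundary is a horizontal boundary. -/
def verticalCycles : ∀ p q, Submodule K (X p q)
  | _, 0 => ⊤
  | p, q + 1 => (LinearMap.range (d p q)).comap (e p q)

/-- The dimension of the elements with both boundaries in the respective other image, modulo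
the horizontal and vertical boundaries. -/
noncomputable def mixedRank (p q : ℕ) : Cardinal.{u} :=
  Module.rank K ((horizontalCycles d e p q ⊓ verticalCycles d e p q).map
    (LinearMap.range (d p q) ⊔ LinearMap.range (e p q)).mkQ)

/-- One step down the staircase: x and y are related when d x = e y. Commutativity and exactness
show that a partner of a mixed cycle is again a mixed cycle. If x = d x' + e x'', then y - d x'' is
killed by e, hence is a vertical boundary; the converse is symmetric. Thus the relation induces an
isomorphism of the quotients. -/
theorem mixedRank_succ_left (hde : ∀ p q x, d p q (e (p + 1) q x) = e p q (d p (q + 1) x))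
    (hd : ∀ p q, Function.Exact (d (p + 1) q) (d p q))
    (he : ∀ p q, Function.Exact (e p (q + 1)) (e p q)) (p q : ℕ) :
    mixedRank d e (p + 1) q = mixedRank d e p (q + 1) := by
  have hdd : ∀ p q x, d p q (d (p + 1) q x) = 0 := fun p q x => (hd p q _).2 ⟨x, rfl⟩
  have hee : ∀ p q x, e p q (e p (q + 1) x) = 0 := fun p q x => (he p q _).2 ⟨x, rfl⟩
  refine rank_map_eq_of_relation _ _ _ _
    (LinearMap.eqLocus (d p q ∘ₗ LinearMap.fst K _ _) (e p q ∘ₗ LinearMap.snd K _ _)) ?_ ?_ ?_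
  · rintro x ⟨⟨y, hy⟩, -⟩
    refine ⟨y, ⟨?_, ⟨x, hy.symm⟩⟩, hy.symm⟩
    cases p with
    | zero => exact Submodule.mem_top
    | succ p =>
      refine (he p q _).1 ?_
      rw [← hde, hy, hdd]
  · rintro y ⟨-, ⟨x, hx⟩⟩
    refine ⟨x, ⟨⟨y, hx.symm⟩, ?_⟩, hx⟩
    cases q with
    | zero => exact Submodule.mem_top
    | succ q =>
      refine (hd p q _).1 ?_
      rw [hde, hx, hee]
  · rintro x - y - (hxy : d p q x = e p q y)
    simp only [Submodule.mkQ_apply, Submodule.Quotient.mk_eq_zero]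
    constructor
    · intro hx
      obtain ⟨_, ⟨x', rfl⟩, _, ⟨x'', rfl⟩, rfl⟩ := Submodule.mem_sup.1 hx
      rw [map_add, hdd, zero_add, hde] at hxy
      obtain ⟨z, hz⟩ := (he p q (y - d p (q + 1) x'')).1 (by rw [map_sub, hxy, sub_self])
      exact Submodule.mem_sup.2 ⟨_, ⟨x'', rfl⟩, _, ⟨z, rfl⟩, by rw [hz]; abel⟩
    · intro hy
      obtain ⟨_, ⟨y', rfl⟩, _, ⟨y'', rfl⟩, rfl⟩ := Submodule.mem_sup.1 hy
      rw [map_add, hee, add_zero, ← hde] at hxy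
      obtain ⟨z, hz⟩ := (hd p q (x - e (p + 1) q y')).1 (by rw [map_sub, hxy, sub_self])
      exact Submodule.mem_sup.2 ⟨_, ⟨z, rfl⟩, _, ⟨y', rfl⟩, by rw [hz]; abel⟩

theorem mixedRank_zero_right (hde : ∀ p q x, d p q (e (p + 1) q x) = e p q (d p (q + 1) x))
    (hd : ∀ p q, Function.Exact (d (p + 1) q) (d p q))
    (he : ∀ p q, Function.Exact (e p (q + 1)) (e p q)) (i : ℕ) :
    mixedRank d e i 0 = mixedRank d e 0 i := by
  -- Each step moves along the antidiagonal, lowering p and raising q, so q must stay free in the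
  -- induction.
  have h : ∀ p q, mixedRank d e p q = mixedRank d e 0 (p + q) := by
    intro p
    induction p with
    | zero => intro q; rw [Nat.zero_add]
    | succ p ih =>
      intro q
      rw [mixedRank_succ_left d e hde hd he, ih]
      congr 1
      omega
  exact h i 0

/-- The homology of an augmentation `Y` of the rows of a double complex with exact columns. -/
theorem seqHomologyRank_eq_mixedRank
    {Y : ℕ → Type u} [∀ i, AddCommGroup (Y i)] [∀ i, Module K (Y i)]
    (δ : ∀ i, Y (i + 1) →ₗ[K] Y i) (ε : ∀ i, X i 0 →ₗ[K] Y i)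
    (hε : ∀ i, Function.Surjective (ε i)) (hex : ∀ i, Function.Exact (e i 0) (ε i))
    (hcomm : ∀ i x, ε i (d i 0 x) = δ i (ε (i + 1) x)) (i : ℕ) :
    seqHomologyRank δ i = mixedRank d e i 0 := by
  symm
  have hc : ∀ x, x ∈ horizontalCycles d e i 0 ⊓ verticalCycles d e i 0 ↔
      ε i x ∈ seqCycles δ i := by
    intro x
    cases i with
    | zero => exact ⟨fun _ => trivial, fun _ => ⟨trivial, trivial⟩⟩
    | succ p =>
      refine Iff.trans ⟨fun h => h.1, fun h => ⟨h, trivial⟩⟩ ?_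
      change d p 0 x ∈ Set.range (e p 0) ↔ δ p (ε (p + 1) x) = 0
      rw [← hcomm]
      exact (hex p _).symm
  refine rank_map_eq_of_relation _ _ _ _ (LinearMap.graph (ε i))
    (fun x hx => ⟨ε i x, (hc x).1 hx, rfl⟩) (fun y hy => ?_) ?_
  · obtain ⟨x, rfl⟩ := hε i y
    exact ⟨x, (hc x).2 hy, rfl⟩
  · rintro x - y - (rfl : y = ε i x)
    simp only [Submodule.mkQ_apply, Submodule.Quotient.mk_eq_zero]
    constructor
    · intro hx
      obtain ⟨_, ⟨x', rfl⟩, _, ⟨x'', rfl⟩, rfl⟩ := Submodule.mem_sup.1 hx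
      have h0 : ε i (e i 0 x'') = 0 := (hex i _).2 ⟨x'', rfl⟩
      exact ⟨ε (i + 1) x', by rw [map_add, h0, add_zero, hcomm]⟩
    · rintro ⟨y, hy⟩
      obtain ⟨x', rfl⟩ := hε (i + 1) y
      obtain ⟨z, hz⟩ := (hex i (x - d i 0 x')).1 (by rw [map_sub, hcomm, hy, sub_self])
      exact Submodule.mem_sup.2 ⟨_, ⟨x', rfl⟩, _, ⟨z, rfl⟩, by rw [hz]; abel⟩

/-- Exchanging the two directions of a double complex. -/
theorem mixedRank_swap {X' : ℕ → ℕ → Type u} [∀ p q, AddCommGroup (X' p q)]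
    [∀ p q, Module K (X' p q)] (d' : ∀ p q, X' (p + 1) q →ₗ[K] X' p q)
    (e' : ∀ p q, X' p (q + 1) →ₗ[K] X' p q) (τ : ∀ p q, X p q ≃ₗ[K] X' q p)
    (h1 : ∀ p q x, τ p q (d p q x) = e' q p (τ (p + 1) q x))
    (h2 : ∀ p q x, τ p q (e p q x) = d' q p (τ p (q + 1) x)) (p q : ℕ) :
    mixedRank d e p q = mixedRank d' e' q p := by
  have hr1 : ∀ p q x, x ∈ LinearMap.range (d p q) ↔ τ p q x ∈ LinearMap.range (e' q p) := by
    intro p q x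
    constructor
    · rintro ⟨z, rfl⟩
      exact ⟨_, (h1 p q z).symm⟩
    · rintro ⟨z, hz⟩
      exact ⟨(τ (p + 1) q).symm z, (τ p q).injective (by rw [h1]; simpa using hz)⟩
  have hr2 : ∀ p q x, x ∈ LinearMap.range (e p q) ↔ τ p q x ∈ LinearMap.range (d' q p) := by
    intro p q x
    constructor
    · rintro ⟨z, rfl⟩
      exact ⟨_, (h2 p q z).symm⟩
    · rintro ⟨z, hz⟩
      exact ⟨(τ p (q + 1)).symm z, (τ p q).injective (by rw [h2]; simpa using hz)⟩
  have hc1 : ∀ x, x ∈ horizontalCycles d e p q ↔ τ p q x ∈ verticalCycles d' e' q p := by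
    intro x
    cases p with
    | zero => cases q <;> exact ⟨fun _ => trivial, fun _ => trivial⟩
    | succ p =>
      change d p q x ∈ LinearMap.range (e p q) ↔
        e' q p (τ (p + 1) q x) ∈ LinearMap.range (d' q p)
      rw [hr2, h1]
  have hc2 : ∀ x, x ∈ verticalCycles d e p q ↔ τ p q x ∈ horizontalCycles d' e' q p := by
    intro x
    cases q with
    | zero => cases p <;> exact ⟨fun _ => trivial, fun _ => trivial⟩
    | succ q =>
      have h : x ∈ verticalCycles d e p (q + 1) ↔ e p q x ∈ LinearMap.range (d p q) := by
        cases p <;> exact Iff.rfl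
      rw [h]
      change _ ↔ d' q p (τ p (q + 1) x) ∈ LinearMap.range (e' q p)
      rw [hr1, h2]
  have hc : ∀ x, x ∈ horizontalCycles d e p q ⊓ verticalCycles d e p q ↔
      τ p q x ∈ horizontalCycles d' e' q p ⊓ verticalCycles d' e' q p := by
    intro x
    rw [Submodule.mem_inf, Submodule.mem_inf, hc1, hc2, and_comm]
  have hb : ∀ x, x ∈ LinearMap.range (d p q) ⊔ LinearMap.range (e p q) ↔
      τ p q x ∈ LinearMap.range (d' q p) ⊔ LinearMap.range (e' q p) := by
    intro x
    simp only [Submodule.mem_sup]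
    constructor
    · rintro ⟨a, ha, b, hb, rfl⟩
      exact ⟨_, (hr2 p q b).1 hb, _, (hr1 p q a).1 ha, by rw [map_add, add_comm]⟩
    · rintro ⟨a, ha, b, hb, h⟩
      refine ⟨(τ p q).symm b, (hr1 p q _).2 (by simpa using hb),
        (τ p q).symm a, (hr2 p q _).2 (by simpa using ha), ?_⟩
      rw [← map_add, add_comm, h, LinearEquiv.symm_apply_apply]
  refine rank_map_eq_of_relation _ _ _ _ (LinearMap.graph (τ p q).toLinearMap)
    (fun x hx => ⟨τ p q x, (hc x).1 hx, rfl⟩)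
    (fun y hy => ⟨(τ p q).symm y, (hc _).2 (by simpa using hy),
      by simp [LinearMap.mem_graph_iff]⟩) ?_
  rintro x - y - (rfl : y = τ p q x)
  simpa only [Submodule.mkQ_apply, Submodule.Quotient.mk_eq_zero] using hb x

end DoubleComplex

/-! ### Lower semicontinuity of dimension -/

section Semicontinuity

variable {K : Type u} [Field K]

/-- Lower semicontinuity of the dimension: if every vector of `U x₀` extends to a family of
vectors of the `U x` whose coordinates lie in the algebra `P` of functions, then
`dim (U x₀) ≤ dim (U x)` wherever some `p ∈ P` with `p x₀ ≠ 0` does not vanish. -/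
theorem exists_finrank_le_of_lift {T V : Type*} [AddCommGroup V] [Module K V]
    (P : Subalgebra K (T → K)) (U : T → Submodule K V) [∀ x, FiniteDimensional K (U x)] (x₀ : T)
    (lift : ∀ u ∈ U x₀, ∃ F : T → V, (∀ x, F x ∈ U x) ∧ F x₀ = u ∧
      ∀ φ : V →ₗ[K] K, (fun x => φ (F x)) ∈ P) :
    ∃ p ∈ P, p x₀ ≠ 0 ∧ ∀ x, p x ≠ 0 →
      Module.finrank K (U x₀) ≤ Module.finrank K (U x) := by
  classical
  let b := Module.finBasis K (U x₀)
  have hb : LinearIndependent K (fun i => (b i : V)) :=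
    b.linearIndependent.map' (U x₀).subtype (Submodule.ker_subtype _)
  choose F hF1 hF2 hF3 using fun i => lift (b i) (b i).2
  -- ψ reads off coordinates in the basis `b` of `U x₀`. The determinant of the coordinates of the
  -- lifted basis lies in `P` and equals 1 at `x₀`; where it is nonzero, the lifted vectors are
  -- independent in `U x`.
  obtain ⟨ψ, hψ⟩ := LinearMap.exists_leftInverse_of_injective
    (Fintype.linearCombination K (fun i => (b i : V)))
    (LinearMap.ker_eq_bot.2 (linearIndependent_iff_injective_fintypeLinearCombination.1 hb))
  have hψb : ∀ i, ψ (b i) = Pi.single i 1 := by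
    intro i
    have := LinearMap.congr_fun hψ (Pi.single i 1)
    simpa using this
  let A : T → Matrix (Fin (Module.finrank K (U x₀))) (Fin (Module.finrank K (U x₀))) K :=
    fun x => Matrix.of fun i k => ψ (F i x) k
  refine ⟨fun x => (A x).det, ?_, ?_, ?_⟩
  · have h : (fun x => (A x).det) = ∑ σ : Equiv.Perm (Fin (Module.finrank K (U x₀))),
        ((Equiv.Perm.sign σ : ℤ) : K) • ∏ i, fun x => ψ (F (σ i) x) i := by
      funext x
      simp [Matrix.det_apply', A, Finset.sum_apply, Finset.prod_apply]
    rw [h]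
    refine Subalgebra.sum_mem _ fun σ _ => Subalgebra.smul_mem _ (Subalgebra.prod_mem _ ?_) _
    intro i _
    exact hF3 (σ i) (LinearMap.proj i ∘ₗ ψ)
  · have : A x₀ = 1 := by
      ext i k
      simp only [A, Matrix.of_apply, hF2, hψb, Matrix.one_apply, Pi.single_apply, eq_comm]
    simp only [this, Matrix.det_one]
    exact one_ne_zero
  · intro x hx
    have hrows : LinearIndependent K (fun i => ψ (F i x)) :=
      Matrix.linearIndependent_rows_of_det_ne_zero hx
    have hV : LinearIndependent K (fun i => F i x) := LinearIndependent.of_comp ψ hrows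
    have hU : LinearIndependent K (fun i => (⟨F i x, hF1 i x⟩ : U x)) :=
      LinearIndependent.of_comp (U x).subtype hV
    simpa using hU.fintype_card_le_finrank

end Semicontinuity

/-! ### Maps of free modules acting on tuples -/

section CoordAct

variable {R : Type*} [CommRing R]

/-- The map `N^s → N^r` given by the matrix of a linear map `R^s → R^r`. -/
def coordAct {r s : ℕ} (D : (Fin s → R) →ₗ[R] (Fin r → R)) (N : Type*) [AddCommGroup N]
    [Module R N] : (Fin s → N) →ₗ[R] (Fin r → N) :=
  LinearMap.pi fun k => ∑ l, D (Pi.single l 1) k • LinearMap.proj l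

theorem coordAct_apply {r s : ℕ} (D : (Fin s → R) →ₗ[R] (Fin r → R)) {N : Type*}
    [AddCommGroup N] [Module R N] (v : Fin s → N) (k : Fin r) :
    coordAct D N v k = ∑ l, D (Pi.single l 1) k • v l := by
  simp [coordAct]

theorem apply_eq_sum_single {r s : ℕ} (D : (Fin s → R) →ₗ[R] (Fin r → R)) (v : Fin s → R)
    (k : Fin r) : D v k = ∑ l, v l * D (Pi.single l 1) k := by
  conv_lhs => rw [pi_eq_sum_univ' v, map_sum]
  simp only [Finset.sum_apply, map_smul, Pi.smul_apply, smul_eq_mul]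

theorem coordAct_self {r s : ℕ} (D : (Fin s → R) →ₗ[R] (Fin r → R)) : coordAct D R = D := by
  ext v k
  simp [coordAct_apply, Pi.single_apply]

theorem coordAct_comp {r s t : ℕ} (D : (Fin s → R) →ₗ[R] (Fin r → R))
    (E : (Fin t → R) →ₗ[R] (Fin s → R)) {N : Type*} [AddCommGroup N] [Module R N]
    (v : Fin t → N) : coordAct D N (coordAct E N v) = coordAct (D ∘ₗ E) N v := by
  funext k
  simp only [coordAct_apply, LinearMap.comp_apply, Finset.smul_sum, smul_smul]
  rw [Finset.sum_comm]
  refine Finset.sum_congr rfl fun m _ => ?_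
  rw [← Finset.sum_smul, apply_eq_sum_single D (E (Pi.single m 1)) k]
  simp only [mul_comm]

theorem coordAct_zero {r s : ℕ} {N : Type*} [AddCommGroup N] [Module R N] (v : Fin s → N) :
    coordAct (0 : (Fin s → R) →ₗ[R] (Fin r → R)) N v = 0 := by
  funext k
  simp [coordAct_apply]

theorem coordAct_naturality {r s : ℕ} (D : (Fin s → R) →ₗ[R] (Fin r → R)) {N N' : Type*}
    [AddCommGroup N] [Module R N] [AddCommGroup N'] [Module R N'] (ψ : N →ₗ[R] N')
    (v : Fin s → N) : coordAct D N' (fun l => ψ (v l)) = fun k => ψ (coordAct D N v k) := by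
  funext k
  simp [coordAct_apply]

/-- When the coefficients are themselves tuples, D acts on each slice separately. This is why
transposition exchanges the two differentials of F ⊗ G. -/
theorem coordAct_pi {r s t : ℕ} (D : (Fin s → R) →ₗ[R] (Fin r → R)) (v : Fin s → Fin t → R)
    (l : Fin t) : (fun k => coordAct D (Fin t → R) v k l) = D (fun m => v m l) := by
  funext k
  rw [coordAct_apply, apply_eq_sum_single]
  simp [mul_comm]

/-- `R^r ⊗ N` is `N^r`. -/
noncomputable def tensorCoord (r : ℕ) (N : Type*) [AddCommGroup N] [Module R N] :
    (Fin r → R) ⊗[R] N ≃ₗ[R] (Fin r → N) :=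
  TensorProduct.comm R _ _ ≪≫ₗ TensorProduct.piScalarRight R R N (Fin r)

theorem tensorCoord_tmul {r : ℕ} {N : Type*} [AddCommGroup N] [Module R N] (x : Fin r → R)
    (y : N) (k : Fin r) : tensorCoord r N (x ⊗ₜ y) k = x k • y := by
  simp [tensorCoord, TensorProduct.piScalarRightHom_tmul]

theorem tensorCoord_rTensor {r s : ℕ} (D : (Fin s → R) →ₗ[R] (Fin r → R)) {N : Type*}
    [AddCommGroup N] [Module R N] (t : (Fin s → R) ⊗[R] N) :
    tensorCoord r N (D.rTensor N t) = coordAct D N (tensorCoord s N t) := by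
  induction t with
  | zero => simp
  | add a b ha hb => simp only [map_add, ha, hb]
  | tmul x y =>
    funext k
    rw [LinearMap.rTensor_tmul, tensorCoord_tmul, coordAct_apply, apply_eq_sum_single,
      Finset.sum_smul]
    refine Finset.sum_congr rfl fun l _ => ?_
    rw [tensorCoord_tmul, smul_smul, mul_comm]

end CoordAct

/-! ### Homogeneous maps and tuples of homogeneous elements -/

namespace FGGradedModule

variable {K : Type u} [Field K] {n : ℕ}

theorem proj_mem (M : FGGradedModule K n) (j : ℤ) (m : M.carrier) : M.proj j m ∈ M.part j :=
  Subtype.property _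

/-- Two linear maps that agree on homogeneous elements agree. -/
theorem linearMap_ext_part (M : FGGradedModule K n) {V : Type*} [AddCommGroup V] [Module K V]
    {f g : M.carrier →ₗ[K] V} (h : ∀ j, ∀ m ∈ M.part j, f m = g m) : f = g := by
  have hle : (⨆ i, M.part i) ≤ LinearMap.eqLocus f g := iSup_le fun i m hm => h i m hm
  exact LinearMap.ext fun m => hle (M.mem_iSup m)

theorem map_proj {M N : FGGradedModule K n}
    {φ : M.carrier →ₗ[MvPolynomial (Fin n) K] N.carrier} (hφ : M.IsGradedHom N φ) (j : ℤ)
    (y : M.carrier) : φ (M.proj j y) = N.proj j (φ y) := by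
  refine LinearMap.congr_fun (f := φ.restrictScalars K ∘ₗ M.proj j)
    (g := N.proj j ∘ₗ φ.restrictScalars K) (M.linearMap_ext_part fun i m hm => ?_) y
  change φ (M.proj j m) = N.proj j (φ m)
  by_cases hij : i = j
  · subst hij
    rw [M.proj_same i m hm, N.proj_same i _ (hφ i m hm)]
  · rw [M.proj_ne i j hij m hm, N.proj_ne i j hij _ (hφ i m hm), map_zero]

/-- Homogeneous maps commute with projections, so the degree-j component of any preimage is again a
preimage. -/
theorem exists_part_preimage {M N : FGGradedModule K n}
    {φ : M.carrier →ₗ[MvPolynomial (Fin n) K] N.carrier} (hφ : M.IsGradedHom N φ) {j : ℤ}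
    {y : N.carrier} (hy : y ∈ N.part j) (h : y ∈ Set.range φ) : ∃ x ∈ M.part j, φ x = y := by
  obtain ⟨x, rfl⟩ := h
  exact ⟨M.proj j x, M.proj_mem j x, by rw [map_proj hφ, N.proj_same j _ hy]⟩

theorem proj_smul (N : FGGradedModule K n) {b c j : ℤ} (h : b + c = j)
    {s : MvPolynomial (Fin n) K} (hs : s ∈ stdGrading K n b) (m : N.carrier) :
    N.proj j (s • m) = s • N.proj c m := by
  subst h
  refine LinearMap.congr_fun (f := N.proj (b + c) ∘ₗ Algebra.lsmul K K N.carrier s)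
    (g := Algebra.lsmul K K N.carrier s ∘ₗ N.proj c) (N.linearMap_ext_part fun i m hm => ?_) m
  change N.proj (b + c) (s • m) = s • N.proj c m
  by_cases hi : i = c
  · subst hi
    rw [N.proj_same i m hm, N.proj_same _ _ (N.smul_mem hs hm)]
  · rw [N.proj_ne i c hi m hm, N.proj_ne _ _ (fun h => hi (by linarith)) _ (N.smul_mem hs hm),
      smul_zero]

/-- The tuples in `N^r` of total degree `j`, where the `k`-th coordinate is shifted by `a k`. -/
def vecPart (N : FGGradedModule K n) {r : ℕ} (a : Fin r → ℤ) (j : ℤ) :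
    Submodule K (Fin r → N.carrier) :=
  Submodule.pi Set.univ fun k => N.part (j - a k)

theorem mem_vecPart {N : FGGradedModule K n} {r : ℕ} {a : Fin r → ℤ} {j : ℤ}
    {v : Fin r → N.carrier} : v ∈ N.vecPart a j ↔ ∀ k, v k ∈ N.part (j - a k) :=
  ⟨fun h k => h k trivial, fun h k _ => h k⟩

theorem single_one_mem {r : ℕ} (a : Fin r → ℤ) (k : Fin r) :
    (Pi.single k 1 : Fin r → MvPolynomial (Fin n) K) ∈ (free a).part (a k) := by
  intro m _
  by_cases hm : m = k
  · subst hm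
    have : (1 : MvPolynomial (Fin n) K) ∈ stdGrading K n (a m - a m) := by
      rw [sub_self]
      exact isWeightedHomogeneous_one K _
    simpa using this
  · rw [Pi.single_eq_of_ne hm]
    exact zero_mem _

theorem entry_mem {r s : ℕ} {a : Fin s → ℤ} {b : Fin r → ℤ}
    {D : (Fin s → MvPolynomial (Fin n) K) →ₗ[MvPolynomial (Fin n) K]
      (Fin r → MvPolynomial (Fin n) K)}
    (hD : (free a).IsGradedHom (free b) D) (l : Fin s) (k : Fin r) :
    D (Pi.single l 1) k ∈ stdGrading K n (a l - b k) :=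
  hD (a l) (Pi.single l 1) (single_one_mem a l) k trivial

theorem coordAct_mem {r s : ℕ} {a : Fin s → ℤ} {b : Fin r → ℤ}
    {D : (Fin s → MvPolynomial (Fin n) K) →ₗ[MvPolynomial (Fin n) K]
      (Fin r → MvPolynomial (Fin n) K)}
    (hD : (free a).IsGradedHom (free b) D) (N : FGGradedModule K n) {j : ℤ}
    {v : Fin s → N.carrier} (hv : v ∈ N.vecPart a j) :
    coordAct D N.carrier v ∈ N.vecPart b j := by
  rw [mem_vecPart] at hv ⊢
  intro k
  rw [coordAct_apply]
  refine Submodule.sum_mem _ fun l _ => ?_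
  have := N.smul_mem (entry_mem hD l k) (hv l)
  rwa [show a l - b k + (j - a l) = j - b k by ring] at this

/-- The piece of degree `j` of the map `N^s → N^r` given by a homogeneous map of graded free
modules. -/
noncomputable def gradedAct {r s : ℕ} {a : Fin s → ℤ} {b : Fin r → ℤ}
    (D : (Fin s → MvPolynomial (Fin n) K) →ₗ[MvPolynomial (Fin n) K]
      (Fin r → MvPolynomial (Fin n) K))
    (hD : (free a).IsGradedHom (free b) D) (N : FGGradedModule K n) (j : ℤ) :
    N.vecPart a j →ₗ[K] N.vecPart b j :=
  ((coordAct D N.carrier).restrictScalars K).restrict fun _ hv => coordAct_mem hD N hv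

/-- The entries of D are homogeneous, so taking in each coordinate the component of the appropriate
degree commutes with D. Hence boundaries of degree j are boundaries of tuples of degree j. -/
theorem exists_vecPart_preimage {r s : ℕ} {a : Fin s → ℤ} {b : Fin r → ℤ}
    {D : (Fin s → MvPolynomial (Fin n) K) →ₗ[MvPolynomial (Fin n) K]
      (Fin r → MvPolynomial (Fin n) K)}
    (hD : (free a).IsGradedHom (free b) D) (N : FGGradedModule K n) {j : ℤ}
    (v : Fin s → N.carrier) (hv : coordAct D N.carrier v ∈ N.vecPart b j) :
    ∃ v' ∈ N.vecPart a j, coordAct D N.carrier v' = coordAct D N.carrier v := by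
  refine ⟨fun l => N.proj (j - a l) (v l), mem_vecPart.2 fun l => N.proj_mem _ _, ?_⟩
  funext k
  have h := N.proj_same _ _ (mem_vecPart.1 hv k)
  rw [coordAct_apply] at h ⊢
  rw [map_sum] at h
  rw [coordAct_apply, ← h]
  refine Finset.sum_congr rfl fun l _ => ?_
  exact (N.proj_smul (by ring) (entry_mem hD l k) (v l)).symm

/-- The map on tuples of total degree `j` given by a homogeneous map. -/
noncomputable def vecMap {M N : FGGradedModule K n} (φ : M.carrier →ₗ[MvPolynomial (Fin n) K] N.carrier)
    (hφ : M.IsGradedHom N φ) {r : ℕ} (a : Fin r → ℤ) (j : ℤ) :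
    M.vecPart a j →ₗ[K] N.vecPart a j :=
  ((φ.restrictScalars K).compLeft (Fin r)).restrict
    fun _ hv => mem_vecPart.2 fun k => hφ _ _ (mem_vecPart.1 hv k)

theorem vecMap_surjective {M N : FGGradedModule K n}
    {φ : M.carrier →ₗ[MvPolynomial (Fin n) K] N.carrier}
    (hφ : M.IsGradedHom N φ) (hs : Function.Surjective φ) {r : ℕ} (a : Fin r → ℤ) (j : ℤ) :
    Function.Surjective (vecMap φ hφ a j) := by
  rintro ⟨v, hv⟩
  choose x hx hx' using fun k => exists_part_preimage hφ (mem_vecPart.1 hv k) (hs (v k))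
  exact ⟨⟨x, mem_vecPart.2 hx⟩, Subtype.ext (funext hx')⟩

theorem vecMap_exact {M N P : FGGradedModule K n}
    {φ : M.carrier →ₗ[MvPolynomial (Fin n) K] N.carrier} (hφ : M.IsGradedHom N φ)
    {ψ : N.carrier →ₗ[MvPolynomial (Fin n) K] P.carrier} (hψ : N.IsGradedHom P ψ)
    (h : Function.Exact φ ψ) {r : ℕ} (a : Fin r → ℤ) (j : ℤ) :
    Function.Exact (vecMap φ hφ a j) (vecMap ψ hψ a j) := by
  rintro ⟨v, hv⟩
  constructor
  · intro h0
    have h0' : ∀ k, ψ (v k) = 0 := fun k => congrFun (congrArg Subtype.val h0) k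
    choose x hx hx' using fun k =>
      exists_part_preimage hφ (mem_vecPart.1 hv k) ((h (v k)).1 (h0' k))
    exact ⟨⟨x, mem_vecPart.2 hx⟩, Subtype.ext (funext hx')⟩
  · rintro ⟨⟨x, hx⟩, hxv⟩
    refine Subtype.ext (funext fun k => ?_)
    have : v k = φ (x k) := (congrFun (congrArg Subtype.val hxv) k).symm
    exact (h (v k)).2 ⟨x k, this.symm⟩

/-- Transposition of matrices of polynomials of total degree `j`. -/
noncomputable def vecSwap {r s : ℕ} (a : Fin r → ℤ) (b : Fin s → ℤ) (j : ℤ) :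
    (free (K := K) (n := n) b).vecPart a j ≃ₗ[K] (free (K := K) (n := n) a).vecPart b j where
  toFun v := ⟨fun l k => v.1 k l, mem_vecPart.2 fun l k _ => by
    have : v.1 k l ∈ stdGrading K n (j - a k - b l) := mem_vecPart.1 v.2 k l trivial
    rwa [sub_right_comm] at this⟩
  invFun v := ⟨fun l k => v.1 k l, mem_vecPart.2 fun l k _ => by
    have : v.1 k l ∈ stdGrading K n (j - b k - a l) := mem_vecPart.1 v.2 k l trivial
    rwa [sub_right_comm] at this⟩
  map_add' _ _ := rfl
  map_smul' _ _ := rfl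
  left_inv _ := rfl
  right_inv _ := rfl

theorem vecSwap_gradedAct {r s t : ℕ} {a : Fin s → ℤ} {b : Fin r → ℤ} (c : Fin t → ℤ)
    (D : (Fin s → MvPolynomial (Fin n) K) →ₗ[MvPolynomial (Fin n) K]
      (Fin r → MvPolynomial (Fin n) K))
    (hD : (free a).IsGradedHom (free b) D) (j : ℤ) (v : (free (K := K) (n := n) c).vecPart a j) :
    vecSwap b c j (gradedAct D hD (free c) j v) = vecMap D hD c j (vecSwap a c j v) :=
  Subtype.ext (funext fun l => coordAct_pi D v.1 l)

/-- Transposing twice is the identity, so this is `vecSwap_gradedAct` read backwards. -/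
theorem vecSwap_vecMap {r s t : ℕ} {a : Fin s → ℤ} {b : Fin r → ℤ} (c : Fin t → ℤ)
    (D : (Fin s → MvPolynomial (Fin n) K) →ₗ[MvPolynomial (Fin n) K]
      (Fin r → MvPolynomial (Fin n) K))
    (hD : (free a).IsGradedHom (free b) D) (j : ℤ) (v : (free (K := K) (n := n) a).vecPart c j) :
    vecSwap c b j (vecMap D hD c j v) = gradedAct D hD (free c) j (vecSwap c a j v) := by
  apply (vecSwap b c j).injective
  rw [vecSwap_gradedAct]
  rfl

theorem vecMap_gradedAct {r s : ℕ} {a : Fin s → ℤ} {b : Fin r → ℤ}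
    (D : (Fin s → MvPolynomial (Fin n) K) →ₗ[MvPolynomial (Fin n) K]
      (Fin r → MvPolynomial (Fin n) K))
    (hD : (free a).IsGradedHom (free b) D) {M N : FGGradedModule K n}
    (φ : M.carrier →ₗ[MvPolynomial (Fin n) K] N.carrier) (hφ : M.IsGradedHom N φ) (j : ℤ)
    (v : M.vecPart a j) :
    vecMap φ hφ b j (gradedAct D hD M j v) = gradedAct D hD N j (vecMap φ hφ a j v) :=
  Subtype.ext (coordAct_naturality D φ v.1).symm

end FGGradedModule

/-! ### The complex of a resolution in a fixed degree, and balancing -/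

namespace GradedFreeResolution

open FGGradedModule

variable {K : Type u} [Field K] {n : ℕ} {M : FGGradedModule K n} (F : GradedFreeResolution M)

/-- The piece of degree `j` of `F_p ⊗ N`. -/
abbrev strand (N : FGGradedModule K n) (j : ℤ) (p : ℕ) : Type u :=
  N.vecPart (F.shift p) j

/-- The differential of `F ⊗ N` in degree `j`. -/
noncomputable def diff (N : FGGradedModule K n) (j : ℤ) (p : ℕ) :
    F.strand N j (p + 1) →ₗ[K] F.strand N j p :=
  gradedAct (F.d p) (F.d_graded p) N j

theorem d_comp_d (p : ℕ) : F.d p ∘ₗ F.d (p + 1) = 0 :=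
  (F.exact_succ p).linearMap_comp_eq_zero

theorem diff_diff (N : FGGradedModule K n) (j : ℤ) (p : ℕ)
    (x : N.vecPart (F.shift (p + 2)) j) : F.diff N j p (F.diff N j (p + 1) x) = 0 := by
  refine Subtype.ext ((coordAct_comp (F.d p) (F.d (p + 1)) x.1).trans ?_)
  rw [d_comp_d]
  exact coordAct_zero _

theorem tensorCoord_mem (N : FGGradedModule K n) (p : ℕ) (j : ℤ) (t : F.tensor N p) :
    t ∈ F.tensorPart N p j ↔ tensorCoord (F.rank p) N.carrier t ∈ N.vecPart (F.shift p) j := by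
  constructor
  · intro ht
    have hle : F.tensorPart N p j ≤ (N.vecPart (F.shift p) j).comap
        ((tensorCoord (F.rank p) N.carrier).toLinearMap.restrictScalars K) := by
      refine Submodule.span_le.2 ?_
      rintro _ ⟨a, b, x, y, hx, hy, rfl, rfl⟩
      refine mem_vecPart.2 fun k => ?_
      change tensorCoord (F.rank p) N.carrier (x ⊗ₜ y) k ∈ _
      rw [tensorCoord_tmul]
      have := N.smul_mem (hx k trivial) hy
      rwa [show a - F.shift p k + b = a + b - F.shift p k by ring] at this
    exact hle ht
  · intro h
    rw [← (tensorCoord (F.rank p) N.carrier).symm_apply_apply t]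
    set v := tensorCoord (F.rank p) N.carrier t with hv
    have hsum : (tensorCoord (F.rank p) N.carrier).symm v =
        ∑ k, (Pi.single k 1 : Fin (F.rank p) → MvPolynomial (Fin n) K) ⊗ₜ v k := by
      rw [LinearEquiv.symm_apply_eq, map_sum]
      funext l
      rw [Finset.sum_apply]
      simp [tensorCoord_tmul, Pi.single_apply, ite_smul]
    rw [hsum]
    refine Submodule.sum_mem _ fun k _ => Submodule.subset_span
      ⟨F.shift p k, j - F.shift p k, _, _, single_one_mem _ k, mem_vecPart.1 h k, by ring, rfl⟩

/-- The coordinates F_i ⊗ N ≅ N^r carry the definition of Tor_j, a subspace of a quotient of the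
whole tensor product, to the homology of the degree-j strand. Only the boundaries need an argument:
a boundary lying in degree j must come from degree j. -/
theorem rank_torPart (N : FGGradedModule K n) (i : ℕ) (j : ℤ) :
    Module.rank K (F.torPart N i j) = seqHomologyRank (X := F.strand N j) (F.diff N j) i := by
  have hc : ∀ (t : F.tensor N i) (y : N.vecPart (F.shift i) j),
      tensorCoord (F.rank i) N.carrier t = y →
      (t ∈ F.cycles N i ↔ y ∈ seqCycles (X := F.strand N j) (F.diff N j) i) := by
    intro t y hty
    cases i with
    | zero => exact ⟨fun _ => trivial, fun _ => trivial⟩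
    | succ p =>
      change (F.d p).rTensor N.carrier t = 0 ↔ F.diff N j p y = 0
      rw [← (tensorCoord (F.rank p) N.carrier).map_eq_zero_iff, tensorCoord_rTensor, hty]
      exact ⟨fun h => Subtype.ext h, fun h => congrArg Subtype.val h⟩
  refine rank_map_eq_of_relation _ _ _ _ (LinearMap.eqLocus
    ((tensorCoord (F.rank i) N.carrier).toLinearMap.restrictScalars K ∘ₗ LinearMap.fst K _ _)
    ((N.vecPart (F.shift i) j).subtype ∘ₗ LinearMap.snd K _ _)) ?_ ?_ ?_
  · rintro t ⟨ht, ht'⟩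
    exact ⟨⟨_, (F.tensorCoord_mem N i j t).1 ht⟩, (hc t _ rfl).1 ht', rfl⟩
  · intro y hy
    have h := (tensorCoord (R := MvPolynomial (Fin n) K) (F.rank i) N.carrier).apply_symm_apply y.1
    refine ⟨(tensorCoord (F.rank i) N.carrier).symm y.1,
      ⟨(F.tensorCoord_mem N i j _).2 ?_, (hc _ y h).2 hy⟩, h⟩
    rw [h]
    exact y.2
  · intro t _ y _ (hty : tensorCoord (F.rank i) N.carrier t = y)
    change (F.boundaries N i).mkQ t = 0 ↔ _
    simp only [Submodule.mkQ_apply, Submodule.Quotient.mk_eq_zero]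
    constructor
    · rintro ⟨z, rfl⟩
      rw [tensorCoord_rTensor] at hty
      -- The preimage z need not be homogeneous; it is replaced by its part of degree j.
      obtain ⟨v, hv, hv'⟩ := exists_vecPart_preimage (F.d_graded i) N
        (tensorCoord _ N.carrier z) (by rw [hty]; exact y.2)
      exact ⟨⟨v, hv⟩, Subtype.ext (hv'.trans hty)⟩
    · rintro ⟨v, rfl⟩
      refine ⟨(tensorCoord _ N.carrier).symm v.1, (tensorCoord _ N.carrier).injective ?_⟩
      rw [tensorCoord_rTensor, LinearEquiv.apply_symm_apply, hty]
      rfl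

section Balance

variable {N : FGGradedModule K n} (G : GradedFreeResolution N) (j : ℤ)

/-- The piece of degree `j` of `F_p ⊗ G_q`. -/
abbrev cell (p q : ℕ) : Type u := F.strand (free (G.shift q)) j p

/-- The differential of `F ⊗ G` in the direction of `F`. -/
noncomputable def cellLeft (p q : ℕ) : F.cell G j (p + 1) q →ₗ[K] F.cell G j p q :=
  F.diff (free (G.shift q)) j p

/-- The differential of `F ⊗ G` in the direction of `G`. -/
noncomputable def cellRight (p q : ℕ) : F.cell G j p (q + 1) →ₗ[K] F.cell G j p q :=
  vecMap (M := free (G.shift (q + 1))) (N := free (G.shift q)) (G.d q) (G.d_graded q)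
    (F.shift p) j

/-- The symmetry of `F ⊗ G`. -/
noncomputable def cellSwap (p q : ℕ) : F.cell G j p q ≃ₗ[K] G.cell F j q p :=
  vecSwap (F.shift p) (G.shift q) j

theorem cellSwap_cellLeft (p q : ℕ) (x : F.cell G j (p + 1) q) :
    F.cellSwap G j p q (F.cellLeft G j p q x) =
      G.cellRight F j q p (F.cellSwap G j (p + 1) q x) :=
  vecSwap_gradedAct (G.shift q) (F.d p) (F.d_graded p) j x

theorem cellSwap_cellRight (p q : ℕ) (x : F.cell G j p (q + 1)) :
    F.cellSwap G j p q (F.cellRight G j p q x) =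
      G.cellLeft F j q p (F.cellSwap G j p (q + 1) x) :=
  vecSwap_vecMap (F.shift p) (G.d q) (G.d_graded q) j x

theorem cellLeft_cellRight (p q : ℕ) (x : F.cell G j (p + 1) (q + 1)) :
    F.cellLeft G j p q (F.cellRight G j (p + 1) q x) =
      F.cellRight G j p q (F.cellLeft G j p (q + 1) x) :=
  (vecMap_gradedAct (M := free (G.shift (q + 1))) (N := free (G.shift q)) (F.d p)
    (F.d_graded p) (G.d q) (G.d_graded q) j x).symm

theorem cellRight_exact (p q : ℕ) :
    Function.Exact (F.cellRight G j p (q + 1)) (F.cellRight G j p q) :=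
  vecMap_exact (M := free (G.shift (q + 2))) (N := free (G.shift (q + 1)))
    (P := free (G.shift q)) (G.d_graded (q + 1)) (G.d_graded q) (G.exact_succ q) (F.shift p) j

/-- Transposition turns this direction into the differential of F applied to coordinates in a finite
free module, where exactness is that of F itself. -/
theorem cellLeft_exact (p q : ℕ) :
    Function.Exact (F.cellLeft G j (p + 1) q) (F.cellLeft G j p q) := by
  intro x
  have h := G.cellRight_exact F j q p (F.cellSwap G j (p + 1) q x)
  rw [← cellSwap_cellLeft, LinearEquiv.map_eq_zero_iff] at h
  rw [h]
  constructor
  · rintro ⟨y, hy⟩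
    refine ⟨(F.cellSwap G j (p + 2) q).symm y, (F.cellSwap G j (p + 1) q).injective ?_⟩
    rw [cellSwap_cellLeft, LinearEquiv.apply_symm_apply, hy]
  · rintro ⟨y, rfl⟩
    exact ⟨_, (F.cellSwap_cellLeft G j (p + 1) q y).symm⟩

/-- The augmentation G_0 → N presents the strand of F ⊗ N as the cokernel of the vertical maps from
G_1 to G_0. -/
theorem seqHomologyRank_diff_eq_mixedRank (i : ℕ) :
    seqHomologyRank (X := F.strand N j) (F.diff N j) i =
      mixedRank (X := F.cell G j) (F.cellLeft G j) (F.cellRight G j) i 0 :=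
  seqHomologyRank_eq_mixedRank (X := F.cell G j) (Y := F.strand N j) _ _ _
    (fun p => vecMap (M := free (G.shift 0)) G.aug G.aug_graded (F.shift p) j)
    (fun _ => vecMap_surjective (M := free (G.shift 0)) G.aug_graded G.aug_surjective _ j)
    (fun _ => vecMap_exact (M := free (G.shift 1)) (N := free (G.shift 0)) (G.d_graded 0)
      G.aug_graded G.exact_zero _ j)
    (fun p x => vecMap_gradedAct (M := free (G.shift 0)) (F.d p) (F.d_graded p) G.aug
      G.aug_graded j x) i

/-- `Tor` may be computed from a resolution of either argument. -/
theorem rank_torPart_comm (i : ℕ) :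
    Module.rank K (F.torPart N i j) = Module.rank K (G.torPart M i j) := by
  rw [rank_torPart, rank_torPart, seqHomologyRank_diff_eq_mixedRank F G,
    seqHomologyRank_diff_eq_mixedRank G F,
    mixedRank_zero_right (X := F.cell G j) _ _ (F.cellLeft_cellRight G j)
      (F.cellLeft_exact G j) (F.cellRight_exact G j)]
  exact mixedRank_swap (X := F.cell G j) (X' := G.cell F j) _ _ _ _ (F.cellSwap G j)
    (F.cellSwap_cellLeft G j) (F.cellSwap_cellRight G j) 0 i

end Balance

end GradedFreeResolution

-- Balancing twice against one resolution of N shows that F and the chosen resolution of M give the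
-- same dimension. From here on any resolution may be used.
open GradedFreeResolution in
theorem torDim_eq {K : Type u} [Field K] {n : ℕ} {M : FGGradedModule K n}
    (F : GradedFreeResolution M) (N : FGGradedModule K n) (i : ℕ) (j : ℤ) :
    torDim M N i j = seqHomologyRank (X := F.strand N j) (F.diff N j) i := by
  obtain ⟨G⟩ := GradedFreeResolution.nonempty N
  rw [← rank_torPart, rank_torPart_comm F G, torDim, rank_torPart_comm _ G]

theorem torDim_comm {K : Type u} [Field K] {n : ℕ} (M N : FGGradedModule K n) (i : ℕ) (j : ℤ) :
    torDim M N i j = torDim N M i j :=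
  GradedFreeResolution.rank_torPart_comm _ _ j i

/-! ### Finiteness of the graded pieces -/

section Pieces

variable {K : Type u} [Field K] {n : ℕ}

theorem weight_one_int (m : Fin n →₀ ℕ) :
    Finsupp.weight (fun _ : Fin n => (1 : ℤ)) m = (m.degree : ℤ) := by
  rw [Finsupp.weight_apply, Finsupp.sum, Finsupp.degree_apply]
  simp

theorem mem_stdGrading {d : ℤ} {f : MvPolynomial (Fin n) K} :
    f ∈ stdGrading K n d ↔ ∀ m, coeff m f ≠ 0 → (m.degree : ℤ) = d := by
  refine forall_congr' fun m => ?_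
  rw [weight_one_int]

theorem eq_zero_of_mem_stdGrading_neg {d : ℤ} (hd : d < 0) {f : MvPolynomial (Fin n) K}
    (hf : f ∈ stdGrading K n d) : f = 0 := by
  ext m
  by_contra h
  have := mem_stdGrading.1 hf m h
  omega

theorem eq_C_of_mem_stdGrading_zero {f : MvPolynomial (Fin n) K}
    (hf : f ∈ stdGrading K n 0) : f = C (coeff 0 f) := by
  classical
  ext m
  rw [coeff_C]
  split_ifs with h
  · rw [h]
  · by_contra h0
    have := mem_stdGrading.1 hf m h0
    rw [Nat.cast_eq_zero, Finsupp.degree_eq_zero_iff] at this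
    exact h this.symm

instance finiteDimensional_stdGrading (d : ℤ) : FiniteDimensional K (stdGrading K n d) := by
  have hle : stdGrading K n d ≤ restrictTotalDegree (Fin n) K d.toNat := by
    intro f hf
    rw [mem_restrictTotalDegree]
    refine Finset.sup_le fun m hm => ?_
    change m.degree ≤ d.toNat
    have := mem_stdGrading.1 hf m (mem_support_iff.1 hm)
    omega
  exact Submodule.finiteDimensional_of_le hle

end Pieces

namespace FGGradedModule

variable {K : Type u} [Field K] {n : ℕ}

/-- Tuples of total degree `j` are tuples of homogeneous elements. -/
def vecPartEquiv (N : FGGradedModule K n) {r : ℕ} (a : Fin r → ℤ) (j : ℤ) :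
    N.vecPart a j ≃ₗ[K] ∀ k, N.part (j - a k) where
  toFun v k := ⟨v.1 k, mem_vecPart.1 v.2 k⟩
  invFun v := ⟨fun k => v k, mem_vecPart.2 fun k => (v k).2⟩
  map_add' _ _ := rfl
  map_smul' _ _ := rfl
  left_inv _ := rfl
  right_inv _ := rfl

/-- A homogeneous finite free cover maps its degree-j piece onto M_j, and that piece is a finite
product of pieces of S. -/
instance finiteDimensional_part (M : FGGradedModule K n) (j : ℤ) :
    FiniteDimensional K (M.part j) := by
  obtain ⟨r, a, φ, hφ, hs⟩ := M.exists_cover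
  have h1 : FiniteDimensional K ((free (K := K) (n := n) a).part j) :=
    Module.Finite.equiv ((self K n).vecPartEquiv a j).symm
  have h2 : M.part j ≤ ((free a).part j).map (φ.restrictScalars K) := by
    intro m hm
    obtain ⟨x, hx, rfl⟩ := exists_part_preimage (M := free a) hφ hm (hs m)
    exact ⟨x, hx, rfl⟩
  exact Submodule.finiteDimensional_of_le h2

instance finiteDimensional_vecPart (N : FGGradedModule K n) {r : ℕ} (a : Fin r → ℤ) (j : ℤ) :
    FiniteDimensional K (N.vecPart a j) :=
  Module.Finite.equiv (N.vecPartEquiv a j).symm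

/-! ### Resolutions with growing degrees -/

theorem linearCombination_graded {M : FGGradedModule K n} {r : ℕ} {a : Fin r → ℤ}
    {m : Fin r → M.carrier} (hm : ∀ k, m k ∈ M.part (a k)) :
    (free a).IsGradedHom M (Fintype.linearCombination (MvPolynomial (Fin n) K) m) := by
  intro j x hx
  change ∑ k, x k • m k ∈ M.part j
  refine Submodule.sum_mem _ fun k _ => ?_
  have := M.smul_mem (hx k trivial) (hm k)
  rwa [sub_add_cancel] at this

/-- A graded module living in degrees `≥ c` has a free cover with generators in degrees `≥ c`
which is injective in degree `c`. -/
theorem exists_cover_of_bounded (M : FGGradedModule K n) (c : ℤ)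
    (hM : ∀ j < c, M.part j = ⊥) :
    ∃ (r : ℕ) (a : Fin r → ℤ)
      (φ : (Fin r → MvPolynomial (Fin n) K) →ₗ[MvPolynomial (Fin n) K] M.carrier),
      (free a).IsGradedHom M φ ∧ Function.Surjective φ ∧ (∀ k, c ≤ a k) ∧
        ∀ x ∈ (free a).part c, φ x = 0 → x = 0 := by
  obtain ⟨r, a, φ, hφ, hs⟩ := M.exists_cover
  -- The generators of degree c are exchanged for a K-basis of M_c, which secures injectivity in
  -- degree c. Old generators of degree at most c become redundant: they lie in M_c or vanish. Their
  -- slots are filled with 0, declared of degree c + 1 so as not to contribute in degree c.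
  let b := Module.finBasis K (M.part c)
  let a' : Fin (Module.finrank K (M.part c) + r) → ℤ :=
    Fin.append (fun _ => c) (fun k => if c < a k then a k else c + 1)
  let m : Fin (Module.finrank K (M.part c) + r) → M.carrier :=
    Fin.append (fun i => (b i : M.carrier))
      (fun k => if c < a k then φ (Pi.single k 1) else 0)
  have hm : ∀ k, m k ∈ M.part (a' k) := by
    intro k
    refine Fin.addCases (fun i => ?_) (fun i => ?_) k
    · simp only [m, a', Fin.append_left]
      exact (b i).2
    · simp only [m, a', Fin.append_right]
      split_ifs
      · exact hφ _ _ (single_one_mem a i)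
      · exact zero_mem _
  refine ⟨_, a', Fintype.linearCombination (MvPolynomial (Fin n) K) m,
    linearCombination_graded hm, ?_, ?_, ?_⟩
  · rw [← LinearMap.range_eq_top, Fintype.range_linearCombination, eq_top_iff]
    intro y _
    obtain ⟨x, rfl⟩ := hs y
    rw [pi_eq_sum_univ' x, map_sum]
    refine Submodule.sum_mem _ fun k _ => ?_
    rw [map_smul]
    refine Submodule.smul_mem _ _ ?_
    have hk : φ (Pi.single k 1) ∈ M.part (a k) := hφ _ _ (single_one_mem a k)
    rcases lt_trichotomy c (a k) with h | h | h
    · refine Submodule.subset_span ⟨Fin.natAdd _ k, ?_⟩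
      simp [m, h]
    · rw [← h] at hk
      have hb : (⟨φ (Pi.single k 1), hk⟩ : M.part c) = _ := (b.sum_repr _).symm
      have hb' := congrArg (M.part c).subtype hb
      rw [map_sum] at hb'
      change φ (Pi.single k 1) = _ at hb'
      rw [hb']
      refine Submodule.sum_mem _ fun i _ => ?_
      rw [map_smul]
      refine Submodule.smul_of_tower_mem _ _ (Submodule.subset_span ⟨Fin.castAdd r i, ?_⟩)
      simp [m]
    · rw [hM _ h, Submodule.mem_bot] at hk
      rw [hk]
      exact zero_mem _
  · intro k
    refine Fin.addCases (fun i => ?_) (fun i => ?_) k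
    · simp [a']
    · simp only [a', Fin.append_right]
      split_ifs <;> omega
  · intro x hx h0
    have hr : ∀ k, x (Fin.natAdd _ k) = 0 := by
      intro k
      have h1 : x (Fin.natAdd _ k) ∈ stdGrading K n (c - a' (Fin.natAdd _ k)) := hx _ trivial
      refine eq_zero_of_mem_stdGrading_neg ?_ h1
      simp only [a', Fin.append_right]
      split_ifs <;> omega
    have hl : ∀ i, x (Fin.castAdd r i) = C (coeff 0 (x (Fin.castAdd r i))) := by
      intro i
      have h1 : x (Fin.castAdd r i) ∈ stdGrading K n (c - a' (Fin.castAdd r i)) := hx _ trivial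
      simp only [a', Fin.append_left, sub_self] at h1
      exact eq_C_of_mem_stdGrading_zero h1
    rw [Fintype.linearCombination_apply, Fin.sum_univ_add] at h0
    simp only [hr, zero_smul, Finset.sum_const_zero, add_zero] at h0
    -- In degree c only constant coefficients on the basis of M_c survive, so the relation is a
    -- K-linear relation among basis vectors.
    have h2 : ∑ i, coeff 0 (x (Fin.castAdd r i)) • b i = 0 := by
      apply (M.part c).injective_subtype
      rw [map_sum, map_zero, ← h0]
      refine Finset.sum_congr rfl fun i _ => ?_
      rw [hl i, ← algebraMap_eq, algebraMap_smul, map_smul]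
      simp [m]
    have h3 := Fintype.linearIndependent_iff.1 b.linearIndependent _ h2
    funext k
    refine Fin.addCases (fun i => ?_) (fun i => ?_) k
    · rw [hl i, h3 i, C_0, Pi.zero_apply]
    · rw [hr i, Pi.zero_apply]

end FGGradedModule

/-- A finitely generated graded module together with a lower bound for its degrees. -/
structure BoundedModule (K : Type u) [Field K] (n : ℕ) where
  module : FGGradedModule K n
  bound : ℤ
  part_eq_bot : ∀ j < bound, module.part j = ⊥

namespace BoundedModule

open FGGradedModule

variable {K : Type u} [Field K] {n : ℕ}

/-- The rank of a chosen free cover. -/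
noncomputable def coverRank (M : BoundedModule K n) : ℕ :=
  (M.module.exists_cover_of_bounded M.bound M.part_eq_bot).choose

/-- The degrees of the generators of a chosen free cover. -/
noncomputable def coverShift (M : BoundedModule K n) : Fin M.coverRank → ℤ :=
  (M.module.exists_cover_of_bounded M.bound M.part_eq_bot).choose_spec.choose

/-- A chosen free cover. -/
noncomputable def coverMap (M : BoundedModule K n) :
    (Fin M.coverRank → MvPolynomial (Fin n) K) →ₗ[MvPolynomial (Fin n) K] M.module.carrier :=
  (M.module.exists_cover_of_bounded M.bound M.part_eq_bot).choose_spec.choose_spec.choose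

theorem coverMap_spec (M : BoundedModule K n) :
    (free M.coverShift).IsGradedHom M.module M.coverMap ∧ Function.Surjective M.coverMap ∧
      (∀ k, M.bound ≤ M.coverShift k) ∧
        ∀ x ∈ (free M.coverShift).part M.bound, M.coverMap x = 0 → x = 0 :=
  (M.module.exists_cover_of_bounded M.bound M.part_eq_bot).choose_spec.choose_spec.choose_spec

/-- The kernel of the chosen free cover lives in degrees above the bound. -/
noncomputable def syz (M : BoundedModule K n) : BoundedModule K n where
  module := (free M.coverShift).sub (LinearMap.ker M.coverMap)
    (isGradedSubmodule_ker _ _ _ M.coverMap_spec.1)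
  bound := M.bound + 1
  part_eq_bot := by
    intro j hj
    rw [eq_bot_iff]
    rintro ⟨x, hx⟩ (hxj : x ∈ (free M.coverShift).part j)
    refine Subtype.ext ?_
    rcases (Int.lt_add_one_iff.1 hj).lt_or_eq with h | h
    · funext k
      refine eq_zero_of_mem_stdGrading_neg ?_ (hxj k trivial)
      have := M.coverMap_spec.2.2.1 k
      omega
    · subst h
      exact M.coverMap_spec.2.2.2 x hxj hx

/-- The map from the chosen cover of the kernel to the chosen cover. -/
noncomputable def syzMap (M : BoundedModule K n) :
    (Fin M.syz.coverRank → MvPolynomial (Fin n) K) →ₗ[MvPolynomial (Fin n) K]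
      (Fin M.coverRank → MvPolynomial (Fin n) K) :=
  (LinearMap.ker M.coverMap).subtype ∘ₗ M.syz.coverMap

theorem syzMap_exact (M : BoundedModule K n) : Function.Exact M.syzMap M.coverMap := by
  intro y
  constructor
  · intro hy
    obtain ⟨x, hx⟩ := M.syz.coverMap_spec.2.1 ⟨y, hy⟩
    exact ⟨x, congrArg Subtype.val hx⟩
  · rintro ⟨x, rfl⟩
    exact (M.syz.coverMap x).2

theorem syzMap_exact' (M : BoundedModule K n) : Function.Exact M.syz.syzMap M.syzMap := by
  intro y
  exact Iff.trans ⟨fun h => Subtype.ext h, fun h => congrArg Subtype.val h⟩ (M.syz.syzMap_exact y)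

/-- The iterated kernels. -/
noncomputable def iterSyz (M : BoundedModule K n) (p : ℕ) : BoundedModule K n :=
  Nat.rec M (fun _ N => N.syz) p

theorem iterSyz_bound (M : BoundedModule K n) (p : ℕ) : (M.iterSyz p).bound = M.bound + p := by
  induction p with
  | zero => simp [iterSyz]
  | succ p ih =>
    change (M.iterSyz p).bound + 1 = _
    rw [ih]
    push_cast
    ring

/-- A graded free resolution whose degrees grow with the homological degree. -/
noncomputable def resolution (M : BoundedModule K n) : GradedFreeResolution M.module where
  rank p := (M.iterSyz p).coverRank
  shift p := (M.iterSyz p).coverShift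
  d p := (M.iterSyz p).syzMap
  aug := M.coverMap
  d_graded p j x hx := (M.iterSyz (p + 1)).coverMap_spec.1 j x hx
  aug_graded := M.coverMap_spec.1
  aug_surjective := M.coverMap_spec.2.1
  exact_zero := M.syzMap_exact
  exact_succ p := (M.iterSyz p).syzMap_exact'

/-- `Tor_i(M, N)_j` vanishes if `i > j` and `M`, `N` live in nonnegative degrees. -/
theorem _root_.torDim_eq_zero {M N : FGGradedModule K n} (hM : ∀ a < 0, M.part a = ⊥)
    (hN : ∀ a < 0, N.part a = ⊥) {i : ℕ} {j : ℤ} (h : j < i) : torDim M N i j = 0 := by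
  let F : GradedFreeResolution M := resolution ⟨M, 0, hM⟩
  rw [torDim_eq F]
  have : Subsingleton (F.strand N j i) := by
    refine Submodule.subsingleton_iff_eq_bot.2 (eq_bot_iff.2 fun v hv => funext fun k => ?_)
    -- Each syzygy step raises the lower degree bound by one. Generators of F_i thus have degree at
    -- least i > j, and the coordinates of the strand fall into negative degrees of N.
    have h1 : (0 : ℤ) + i ≤ F.shift i k := by
      have := ((⟨M, 0, hM⟩ : BoundedModule K n).iterSyz i).coverMap_spec.2.2.1 k
      rwa [iterSyz_bound] at this
    have h2 := mem_vecPart.1 hv k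
    rwa [hN _ (by omega)] at h2
  exact seqHomologyRank_eq_zero _ _

end BoundedModule

/-! ### Transport along automorphisms of the polynomial ring -/

namespace FGGradedModule

variable {K : Type u} [Field K] {n : ℕ}

/-- A degree-preserving isomorphism of graded modules which is semilinear with respect to an
automorphism of the polynomial ring. -/
structure TwistedIso (σ : MvPolynomial (Fin n) K ≃ₐ[K] MvPolynomial (Fin n) K)
    (M M' : FGGradedModule K n) where
  equiv : M.carrier ≃ₗ[K] M'.carrier
  map_smul : ∀ (s : MvPolynomial (Fin n) K) m, equiv (s • m) = σ s • equiv m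
  mem_iff : ∀ j m, equiv m ∈ M'.part j ↔ m ∈ M.part j

/-- The conjugate of a linear map of free modules by an automorphism of the ring. -/
noncomputable def twistMap (σ : MvPolynomial (Fin n) K ≃ₐ[K] MvPolynomial (Fin n) K) {r s : ℕ}
    (D : (Fin s → MvPolynomial (Fin n) K) →ₗ[MvPolynomial (Fin n) K]
      (Fin r → MvPolynomial (Fin n) K)) :
    (Fin s → MvPolynomial (Fin n) K) →ₗ[MvPolynomial (Fin n) K]
      (Fin r → MvPolynomial (Fin n) K) where
  toFun x k := σ (D (fun l => σ.symm (x l)) k)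
  map_add' x y := by
    have : (fun l => σ.symm ((x + y) l)) =
        (fun l => σ.symm (x l)) + fun l => σ.symm (y l) := by
      funext l
      simp
    funext k
    rw [this, map_add, Pi.add_apply, map_add]
    rfl
  map_smul' s x := by
    have : (fun l => σ.symm ((s • x) l)) = σ.symm s • fun l => σ.symm (x l) := by
      funext l
      simp
    funext k
    rw [this, _root_.map_smul, Pi.smul_apply, smul_eq_mul, map_mul, AlgEquiv.apply_symm_apply]
    rfl

theorem twistMap_apply (σ : MvPolynomial (Fin n) K ≃ₐ[K] MvPolynomial (Fin n) K) {r s : ℕ}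
    (D : (Fin s → MvPolynomial (Fin n) K) →ₗ[MvPolynomial (Fin n) K]
      (Fin r → MvPolynomial (Fin n) K)) (x : Fin s → MvPolynomial (Fin n) K) (k : Fin r) :
    twistMap σ D (fun l => σ (x l)) k = σ (D x k) := by
  simp [twistMap]

theorem TwistedIso.map_coordAct {σ : MvPolynomial (Fin n) K ≃ₐ[K] MvPolynomial (Fin n) K}
    {N N' : FGGradedModule K n} (χ : TwistedIso σ N N') {r s : ℕ}
    (D : (Fin s → MvPolynomial (Fin n) K) →ₗ[MvPolynomial (Fin n) K]
      (Fin r → MvPolynomial (Fin n) K)) (v : Fin s → N.carrier) (k : Fin r) :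
    χ.equiv (coordAct D N.carrier v k) =
      coordAct (twistMap σ D) N'.carrier (fun l => χ.equiv (v l)) k := by
  rw [coordAct_apply, coordAct_apply, map_sum]
  refine Finset.sum_congr rfl fun l _ => ?_
  have h : (fun m => σ ((Pi.single l 1 : Fin s → MvPolynomial (Fin n) K) m)) =
      Pi.single l 1 := by
    funext m
    by_cases hm : m = l
    · subst hm
      simp
    · simp [Pi.single_eq_of_ne hm]
  rw [χ.map_smul, ← twistMap_apply, h]

/-- The isomorphism on tuples of homogeneous elements. -/
def TwistedIso.vecEquiv {σ : MvPolynomial (Fin n) K ≃ₐ[K] MvPolynomial (Fin n) K}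
    {N N' : FGGradedModule K n} (χ : TwistedIso σ N N') {r : ℕ} (a : Fin r → ℤ) (j : ℤ) :
    N.vecPart a j ≃ₗ[K] N'.vecPart a j where
  toFun v := ⟨fun k => χ.equiv (v.1 k),
    mem_vecPart.2 fun k => (χ.mem_iff _ _).2 (mem_vecPart.1 v.2 k)⟩
  invFun v := ⟨fun k => χ.equiv.symm (v.1 k),
    mem_vecPart.2 fun k => (χ.mem_iff _ _).1 (by simpa using mem_vecPart.1 v.2 k)⟩
  map_add' v w := Subtype.ext (funext fun k => map_add _ _ _)
  map_smul' c v := Subtype.ext (funext fun k => _root_.map_smul χ.equiv _ _)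
  left_inv v := Subtype.ext (funext fun k => by simp)
  right_inv v := Subtype.ext (funext fun k => by simp)

theorem twistMap_exact (σ : MvPolynomial (Fin n) K ≃ₐ[K] MvPolynomial (Fin n) K) {r s t : ℕ}
    {D : (Fin s → MvPolynomial (Fin n) K) →ₗ[MvPolynomial (Fin n) K]
      (Fin r → MvPolynomial (Fin n) K)}
    {E : (Fin t → MvPolynomial (Fin n) K) →ₗ[MvPolynomial (Fin n) K]
      (Fin s → MvPolynomial (Fin n) K)} (h : Function.Exact E D) :
    Function.Exact (twistMap σ E) (twistMap σ D) := by
  have hsurj : ∀ {q : ℕ} (y : Fin q → MvPolynomial (Fin n) K),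
      ∃ x : Fin q → MvPolynomial (Fin n) K, y = fun l => σ (x l) :=
    fun y => ⟨fun l => σ.symm (y l), by simp⟩
  intro y
  obtain ⟨x, rfl⟩ := hsurj y
  have h1 : twistMap σ D (fun l => σ (x l)) = 0 ↔ D x = 0 := by
    simp only [funext_iff, twistMap_apply, Pi.zero_apply, EmbeddingLike.map_eq_zero_iff]
  rw [h1, h x]
  constructor
  · rintro ⟨z, rfl⟩
    exact ⟨fun l => σ (z l), funext fun k => twistMap_apply σ E z k⟩
  · rintro ⟨z, hz⟩
    obtain ⟨z, rfl⟩ := hsurj z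
    refine ⟨z, funext fun k => σ.injective ?_⟩
    rw [← twistMap_apply]
    exact congrFun hz k

end FGGradedModule

namespace GradedFreeResolution

open FGGradedModule

variable {K : Type u} [Field K] {n : ℕ}

/-- The resolution of a twisted module. -/
noncomputable def twist {σ : MvPolynomial (Fin n) K ≃ₐ[K] MvPolynomial (Fin n) K}
    (hσ : ∀ d f, σ f ∈ stdGrading K n d ↔ f ∈ stdGrading K n d)
    {M M' : FGGradedModule K n} (ψ : TwistedIso σ M M') (F : GradedFreeResolution M) :
    GradedFreeResolution M' where
  rank := F.rank
  shift := F.shift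
  d p := twistMap σ (F.d p)
  aug :=
    { toFun x := ψ.equiv (F.aug fun l => σ.symm (x l))
      map_add' x y := by
        rw [← map_add, ← map_add]
        congr 2
        funext l
        simp
      map_smul' s x := by
        have : (fun l => σ.symm ((s • x) l)) = σ.symm s • fun l => σ.symm (x l) := by
          funext l
          simp
        rw [this, map_smul, ψ.map_smul, AlgEquiv.apply_symm_apply]
        rfl }
  d_graded p j x hx k _ := (hσ _ _).2 (F.d_graded p j (fun l => σ.symm (x l))
    (fun l _ => (hσ _ _).1 (by simpa using hx l trivial)) k trivial)
  aug_graded j x hx := (ψ.mem_iff _ _).2 (F.aug_graded j (fun l => σ.symm (x l))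
    (fun l _ => (hσ _ _).1 (by simpa using hx l trivial)))
  aug_surjective y := by
    obtain ⟨x, hx⟩ := F.aug_surjective (ψ.equiv.symm y)
    exact ⟨fun l => σ (x l), by simp [hx]⟩
  exact_zero y := by
    change ψ.equiv (F.aug fun l => σ.symm (y l)) = 0 ↔ _
    rw [LinearEquiv.map_eq_zero_iff, F.exact_zero]
    constructor
    · rintro ⟨z, hz⟩
      refine ⟨fun l => σ (z l), funext fun k => ?_⟩
      rw [twistMap_apply, hz]
      simp
    · rintro ⟨z, rfl⟩
      exact ⟨fun l => σ.symm (z l), funext fun k => by simp [twistMap]⟩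
  exact_succ p := twistMap_exact σ (F.exact_succ p)

end GradedFreeResolution

-- An automorphism of S preserving degrees transports the whole computation: conjugating the
-- differentials of F by σ resolves M', and χ, taken coordinatewise, is an isomorphism of strands
-- over K.
open FGGradedModule GradedFreeResolution in
theorem torDim_twist {K : Type u} [Field K] {n : ℕ}
    {σ : MvPolynomial (Fin n) K ≃ₐ[K] MvPolynomial (Fin n) K}
    (hσ : ∀ d f, σ f ∈ stdGrading K n d ↔ f ∈ stdGrading K n d)
    {M M' N N' : FGGradedModule K n} (ψ : TwistedIso σ M M') (χ : TwistedIso σ N N')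
    (i : ℕ) (j : ℤ) : torDim M N i j = torDim M' N' i j := by
  obtain ⟨F⟩ := GradedFreeResolution.nonempty M
  rw [torDim_eq F, torDim_eq (F.twist hσ ψ)]
  exact seqHomologyRank_congr (X := F.strand N j) (X' := (F.twist hσ ψ).strand N' j)
    (F.diff N j) ((F.twist hσ ψ).diff N' j)
    (fun p => χ.vecEquiv (F.shift p) j)
    (fun p v => Subtype.ext (_root_.funext fun k => χ.map_coordAct (F.d p) v.1 k)) i

/-! ### Homogeneous ideals in a fixed degree -/

theorem finrank_map_add_finrank_inf_ker {K V W : Type*} [Field K] [AddCommGroup V] [Module K V]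
    [AddCommGroup W] [Module K W] (f : V →ₗ[K] W) (A : Submodule K V) [FiniteDimensional K A] :
    Module.finrank K (A.map f) + Module.finrank K (A ⊓ LinearMap.ker f : Submodule K V) =
      Module.finrank K A := by
  have h := LinearMap.finrank_range_add_finrank_ker (f ∘ₗ A.subtype)
  rw [LinearMap.range_comp, Submodule.range_subtype, LinearMap.ker_comp] at h
  rw [← h, ← Submodule.map_comap_subtype,
    (Submodule.equivMapOfInjective A.subtype A.injective_subtype _).finrank_eq]

namespace FGGradedModule

variable {K : Type u} [Field K] {n : ℕ}

/-- The piece of degree `d` of a homogeneous ideal. -/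
noncomputable def idealPart (I : HomogeneousIdeal (stdGrading K n)) (d : ℤ) :
    Submodule K (MvPolynomial (Fin n) K) :=
  stdGrading K n d ⊓ I.toIdeal.restrictScalars K

instance finiteDimensional_idealPart (I : HomogeneousIdeal (stdGrading K n)) (d : ℤ) :
    FiniteDimensional K (idealPart I d) :=
  Submodule.finiteDimensional_of_le (inf_le_left : idealPart I d ≤ stdGrading K n d)

/-- The tuples of total degree `j` with coordinates in a homogeneous ideal. -/
noncomputable def idealVec (I : HomogeneousIdeal (stdGrading K n)) {r : ℕ} (a : Fin r → ℤ)
    (j : ℤ) : Submodule K (Fin r → MvPolynomial (Fin n) K) :=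
  Submodule.pi Set.univ fun k => idealPart I (j - a k)

theorem mem_idealVec {I : HomogeneousIdeal (stdGrading K n)} {r : ℕ} {a : Fin r → ℤ} {j : ℤ}
    {v : Fin r → MvPolynomial (Fin n) K} :
    v ∈ idealVec I a j ↔ ∀ k, v k ∈ idealPart I (j - a k) :=
  ⟨fun h k => h k trivial, fun h k _ => h k⟩

/-- Tuples with coordinates in a homogeneous ideal are tuples of elements of pieces. -/
noncomputable def idealVecEquiv (I : HomogeneousIdeal (stdGrading K n)) {r : ℕ} (a : Fin r → ℤ)
    (j : ℤ) : idealVec I a j ≃ₗ[K] ∀ k, idealPart I (j - a k) where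
  toFun v k := ⟨v.1 k, mem_idealVec.1 v.2 k⟩
  invFun v := ⟨fun k => v k, mem_idealVec.2 fun k => (v k).2⟩
  map_add' _ _ := rfl
  map_smul' _ _ := rfl
  left_inv _ := rfl
  right_inv _ := rfl

instance finiteDimensional_idealVec (I : HomogeneousIdeal (stdGrading K n)) {r : ℕ}
    (a : Fin r → ℤ) (j : ℤ) : FiniteDimensional K (idealVec I a j) :=
  Module.Finite.equiv (idealVecEquiv I a j).symm

theorem finrank_idealVec (I : HomogeneousIdeal (stdGrading K n)) {r : ℕ} (a : Fin r → ℤ)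
    (j : ℤ) : Module.finrank K (idealVec I a j) =
      ∑ k, Module.finrank K (idealPart I (j - a k)) := by
  rw [(idealVecEquiv I a j).finrank_eq, Module.finrank_pi_fintype]

/-- The tuples over the graded module `I` are the tuples with coordinates in `I`. -/
noncomputable def ofIdealVecEquiv (I : HomogeneousIdeal (stdGrading K n)) {r : ℕ}
    (a : Fin r → ℤ) (j : ℤ) : (ofIdeal I).vecPart a j ≃ₗ[K] idealVec I a j where
  toFun v := ⟨fun k => (v.1 k).1,
    mem_idealVec.2 fun k => ⟨mem_vecPart.1 v.2 k, (v.1 k).2⟩⟩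
  invFun v := ⟨fun k => ⟨v.1 k, (mem_idealVec.1 v.2 k).2⟩,
    mem_vecPart.2 fun k => (mem_idealVec.1 v.2 k).1⟩
  map_add' _ _ := rfl
  map_smul' _ _ := rfl
  left_inv _ := rfl
  right_inv _ := rfl

/-! ### Ranks of strand maps with coefficients in I and S/I -/

section Ranks

variable {r s : ℕ} {a : Fin s → ℤ} {b : Fin r → ℤ}
  {D : (Fin s → MvPolynomial (Fin n) K) →ₗ[MvPolynomial (Fin n) K]
    (Fin r → MvPolynomial (Fin n) K)}
  (hD : (free a).IsGradedHom (free b) D) (I : HomogeneousIdeal (stdGrading K n)) (j : ℤ)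

/-- The inclusion of I in S moves the image, without changing its dimension, into the space S^r,
which does not depend on I. Images for different ideals can then be compared by semicontinuity. -/
theorem finrank_range_gradedAct_ofIdeal :
    Module.finrank K (LinearMap.range (gradedAct D hD (ofIdeal I) j)) =
      Module.finrank K ((idealVec I a j).map (D.restrictScalars K)) := by
  let ι : (ofIdeal I).vecPart b j →ₗ[K] (Fin r → MvPolynomial (Fin n) K) :=
    (idealVec I b j).subtype ∘ₗ (ofIdealVecEquiv I b j).toLinearMap
  have hι : Function.Injective ι :=
    (idealVec I b j).injective_subtype.comp (ofIdealVecEquiv I b j).injective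
  have hcomm : ∀ v : (ofIdeal I).vecPart a j, ι (gradedAct D hD (ofIdeal I) j v) =
      D (ofIdealVecEquiv I a j v).1 := by
    intro v
    have h := coordAct_naturality D I.toIdeal.subtype v.1
    rw [coordAct_self] at h
    exact h.symm
  have hmap : (LinearMap.range (gradedAct D hD (ofIdeal I) j)).map ι =
      (idealVec I a j).map (D.restrictScalars K) := by
    ext y
    constructor
    · rintro ⟨_, ⟨v, rfl⟩, rfl⟩
      exact ⟨_, (ofIdealVecEquiv I a j v).2, (hcomm v).symm⟩
    · rintro ⟨v, hv, rfl⟩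
      refine ⟨_, ⟨(ofIdealVecEquiv I a j).symm ⟨v, hv⟩, rfl⟩, ?_⟩
      rw [hcomm, LinearEquiv.apply_symm_apply]
      rfl
  rw [← hmap]
  exact (Submodule.equivMapOfInjective ι hι _).finrank_eq

theorem quotient_graded :
    (self K n).IsGradedHom (ofQuotient I) (Submodule.mkQ I.toIdeal) :=
  fun _ x hx => ⟨x, hx, rfl⟩

theorem finrank_vecPart_ofQuotient_add :
    Module.finrank K ((ofQuotient I).vecPart a j) + Module.finrank K (idealVec I a j) =
      Module.finrank K ((self K n).vecPart a j) := by
  have hs : Function.Surjective (vecMap (M := self K n) (N := ofQuotient I)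
      (Submodule.mkQ I.toIdeal) (quotient_graded I) a j) :=
    vecMap_surjective (quotient_graded I) (Submodule.mkQ_surjective _) a j
  have h := LinearMap.finrank_range_add_finrank_ker (vecMap (M := self K n)
    (N := ofQuotient I) (Submodule.mkQ I.toIdeal) (quotient_graded I) a j)
  rw [LinearMap.range_eq_top.2 hs, finrank_top] at h
  rw [← h]
  congr 1
  have hle : idealVec I a j ≤ (self K n).vecPart a j := fun v hv k hk => (hv k hk).1
  have hk : LinearMap.ker (vecMap (M := self K n) (N := ofQuotient I)
      (Submodule.mkQ I.toIdeal) (quotient_graded I) a j) =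
      (idealVec I a j).comap ((self K n).vecPart a j).subtype := by
    ext ⟨v, hv⟩
    rw [LinearMap.mem_ker]
    constructor
    · intro h0
      refine mem_idealVec.2 fun k => ⟨mem_vecPart.1 hv k, ?_⟩
      exact (Submodule.Quotient.mk_eq_zero _).1 (congrFun (congrArg Subtype.val h0) k)
    · intro h0
      exact Subtype.ext (_root_.funext fun k =>
        (Submodule.Quotient.mk_eq_zero _).2 (mem_idealVec.1 h0 k).2)
  rw [hk, (Submodule.comapSubtypeEquivOfLe hle).finrank_eq]

/-- The image over S/I is (D(S^s)_j + (I^r)_j)/(I^r)_j. Adding the dimension of the denominator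
turns its dimension into that of a subspace of S^r, an ambient space independent of I. -/
theorem finrank_range_gradedAct_ofQuotient_add :
    Module.finrank K (LinearMap.range (gradedAct D hD (ofQuotient I) j)) +
        Module.finrank K (idealVec I b j) =
      Module.finrank K (((self K n).vecPart a j).map (D.restrictScalars K) ⊔
        idealVec I b j : Submodule K (Fin r → MvPolynomial (Fin n) K)) := by
  let ρ : (Fin r → MvPolynomial (Fin n) K) →ₗ[K] (Fin r → MvPolynomial (Fin n) K ⧸ I.toIdeal) :=
    ((Submodule.mkQ I.toIdeal).restrictScalars K).compLeft (Fin r)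
  have hρ : ∀ v, ρ v = 0 ↔ ∀ k, v k ∈ I.toIdeal := by
    intro v
    rw [funext_iff]
    exact forall_congr' fun k => Submodule.Quotient.mk_eq_zero _
  have h1 : (idealVec I b j) ≤ LinearMap.ker ρ :=
    fun v hv => (hρ v).2 fun k => (mem_idealVec.1 hv k).2
  have h2 : ((self K n).vecPart a j).map (D.restrictScalars K) ≤ (self K n).vecPart b j := by
    rintro _ ⟨v, hv, rfl⟩
    have := coordAct_mem hD (self K n) hv
    rwa [coordAct_self] at this
  have h3 : idealVec I b j ≤ (self K n).vecPart b j := fun v hv k hk => (hv k hk).1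
  -- D is homogeneous, so the sum lies in degree j, and there reduction modulo I kills exactly the
  -- tuples of degree j with entries in I.
  have h4 : ((((self K n).vecPart a j).map (D.restrictScalars K) ⊔ idealVec I b j) ⊓
      LinearMap.ker ρ : Submodule K (Fin r → MvPolynomial (Fin n) K)) = idealVec I b j := by
    refine le_antisymm (fun v hv => mem_idealVec.2 fun k => ⟨?_, (hρ v).1 hv.2 k⟩)
      (le_inf le_sup_right h1)
    exact mem_vecPart.1 (sup_le h2 h3 hv.1) k
  have h5 : (((self K n).vecPart a j).map (D.restrictScalars K) ⊔ idealVec I b j).map ρ =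
      (LinearMap.range (gradedAct D hD (ofQuotient I) j)).map
        ((ofQuotient I).vecPart b j).subtype := by
    have hcomm : ∀ v : Fin s → MvPolynomial (Fin n) K, ρ (D v) =
        coordAct D (MvPolynomial (Fin n) K ⧸ I.toIdeal)
          (fun l => Submodule.mkQ I.toIdeal (v l)) := by
      intro v
      have h := coordAct_naturality D (Submodule.mkQ I.toIdeal) v
      rw [coordAct_self] at h
      exact h.symm
    rw [Submodule.map_sup, LinearMap.le_ker_iff_map.1 h1, sup_bot_eq]
    ext y
    constructor
    · rintro ⟨_, ⟨v, hv, rfl⟩, rfl⟩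
      refine ⟨_, ⟨vecMap (M := self K n) (N := ofQuotient I) (Submodule.mkQ I.toIdeal)
        (quotient_graded I) a j ⟨v, hv⟩, rfl⟩, ?_⟩
      exact (hcomm v).symm
    · rintro ⟨_, ⟨z, rfl⟩, rfl⟩
      obtain ⟨⟨v, hv⟩, rfl⟩ := vecMap_surjective (quotient_graded I)
        (Submodule.mkQ_surjective _) a j z
      exact ⟨_, ⟨v, hv, rfl⟩, hcomm v⟩
  have : FiniteDimensional K (((self K n).vecPart a j).map (D.restrictScalars K)) :=
    have := finiteDimensional_vecPart (self K n) a j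
    Module.Finite.map _ _
  have h6 := finrank_map_add_finrank_inf_ker ρ
    (((self K n).vecPart a j).map (D.restrictScalars K) ⊔ idealVec I b j)
  rw [h4, h5] at h6
  rw [← h6, (Submodule.equivMapOfInjective _ (Submodule.injective_subtype _) _).finrank_eq]

end Ranks

/-! ### Families of ideals -/

/-- A family of homogeneous ideals with constant Hilbert function such that every homogeneous
element of the ideal over `x₀` extends to a family of elements whose coordinates lie in the
algebra `P` of functions on the parameter space. -/
structure IsFlatFamily {T : Type*} (P : Subalgebra K (T → K))
    (J : T → HomogeneousIdeal (stdGrading K n)) (x₀ : T) : Prop where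
  finrank_eq : ∀ x d, Module.finrank K (idealPart (J x) d) =
    Module.finrank K (idealPart (J x₀) d)
  lift : ∀ d, ∀ f ∈ idealPart (J x₀) d, ∃ F : T → MvPolynomial (Fin n) K,
    (∀ x, F x ∈ idealPart (J x) d) ∧ F x₀ = f ∧
      ∀ φ : MvPolynomial (Fin n) K →ₗ[K] K, (fun x => φ (F x)) ∈ P

namespace IsFlatFamily

variable {T : Type*} {P : Subalgebra K (T → K)} {J : T → HomogeneousIdeal (stdGrading K n)}
  {x₀ : T}

theorem finrank_idealVec_eq (h : IsFlatFamily P J x₀) (x : T) {r : ℕ} (a : Fin r → ℤ) (j : ℤ) :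
    Module.finrank K (idealVec (J x) a j) = Module.finrank K (idealVec (J x₀) a j) := by
  rw [finrank_idealVec, finrank_idealVec]
  exact Finset.sum_congr rfl fun k _ => h.finrank_eq x _

/-- Entries are lifted separately; a functional on tuples is a sum of functionals of the entries, so
its values on the lift stay in `P`. -/
theorem lift_vec (h : IsFlatFamily P J x₀) {r : ℕ} {a : Fin r → ℤ} {j : ℤ}
    {v : Fin r → MvPolynomial (Fin n) K} (hv : v ∈ idealVec (J x₀) a j) :
    ∃ F : T → Fin r → MvPolynomial (Fin n) K, (∀ x, F x ∈ idealVec (J x) a j) ∧ F x₀ = v ∧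
      ∀ φ : (Fin r → MvPolynomial (Fin n) K) →ₗ[K] K, (fun x => φ (F x)) ∈ P := by
  choose F h1 h2 h3 using fun k => h.lift _ _ (mem_idealVec.1 hv k)
  refine ⟨fun x k => F k x, fun x => mem_idealVec.2 fun k => h1 k x, _root_.funext h2, fun φ => ?_⟩
  have : (fun x => φ fun k => F k x) = ∑ k, fun x => (φ ∘ₗ LinearMap.single K _ k) (F k x) := by
    funext x
    rw [Finset.sum_apply, ← Finset.univ_sum_single (fun k => F k x), map_sum]
    rfl
  rw [this]
  exact Subalgebra.sum_mem _ fun k _ => h3 k _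

variable {r s : ℕ} {a : Fin s → ℤ} {b : Fin r → ℤ}
  {D : (Fin s → MvPolynomial (Fin n) K) →ₗ[MvPolynomial (Fin n) K]
    (Fin r → MvPolynomial (Fin n) K)}

/-- The image is spanned by the D(v) with v over the ideal, and lifts of v give lifts of D(v) since
D does not depend on the parameter. -/
theorem exists_rank_le_ofIdeal (h : IsFlatFamily P J x₀)
    (hD : (free a).IsGradedHom (free b) D) (j : ℤ) :
    ∃ p ∈ P, p x₀ ≠ 0 ∧ ∀ x, p x ≠ 0 →
      Module.finrank K (LinearMap.range (gradedAct D hD (ofIdeal (J x₀)) j)) ≤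
        Module.finrank K (LinearMap.range (gradedAct D hD (ofIdeal (J x)) j)) := by
  simp only [finrank_range_gradedAct_ofIdeal]
  have : ∀ x, FiniteDimensional K ((idealVec (J x) a j).map (D.restrictScalars K)) :=
    fun x => Module.Finite.map _ _
  refine exists_finrank_le_of_lift P
    (fun x => (idealVec (J x) a j).map (D.restrictScalars K)) x₀ ?_
  rintro _ ⟨v, hv, rfl⟩
  obtain ⟨F, h1, rfl, h3⟩ := h.lift_vec hv
  exact ⟨fun x => D (F x), fun x => ⟨F x, h1 x, rfl⟩, rfl, fun φ => h3 (φ ∘ₗ D.restrictScalars K)⟩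

/-- In D(S^s)_j + (J_x^r)_j the first summand is constant and the second one lifts. Semicontinuity
of the sum is semicontinuity of the rank, because the dimension of (J_x^r)_j is constant. -/
theorem exists_rank_le_ofQuotient (h : IsFlatFamily P J x₀)
    (hD : (free a).IsGradedHom (free b) D) (j : ℤ) :
    ∃ p ∈ P, p x₀ ≠ 0 ∧ ∀ x, p x ≠ 0 →
      Module.finrank K (LinearMap.range (gradedAct D hD (ofQuotient (J x₀)) j)) ≤
        Module.finrank K (LinearMap.range (gradedAct D hD (ofQuotient (J x)) j)) := by
  have hfin : FiniteDimensional K (((self K n).vecPart a j).map (D.restrictScalars K)) :=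
    have := finiteDimensional_vecPart (self K n) a j
    Module.Finite.map _ _
  have := exists_finrank_le_of_lift P
    (fun x => ((self K n).vecPart a j).map (D.restrictScalars K) ⊔ idealVec (J x) b j) x₀ ?_
  · obtain ⟨p, hp, h0, hle⟩ := this
    refine ⟨p, hp, h0, fun x hx => ?_⟩
    have h1 := hle x hx
    have h2 := h.finrank_idealVec_eq x b j
    rw [← finrank_range_gradedAct_ofQuotient_add hD,
      ← finrank_range_gradedAct_ofQuotient_add hD] at h1
    omega
  · intro u hu
    obtain ⟨y, hy, v, hv, rfl⟩ := Submodule.mem_sup.1 hu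
    obtain ⟨F, h1, rfl, h3⟩ := h.lift_vec hv
    refine ⟨fun x => y + F x, fun x => Submodule.add_mem_sup hy (h1 x), rfl, fun φ => ?_⟩
    simp only [map_add]
    exact Subalgebra.add_mem _ (P.algebraMap_mem (φ y)) (h3 φ)

/-- Upper semicontinuity of the dimensions of `Tor` in flat families of ideals. -/
theorem exists_torDim_le (h : IsFlatFamily P J x₀) (M : FGGradedModule K n) (j : ℤ) (B : ℕ) :
    ∃ p ∈ P, p x₀ ≠ 0 ∧ ∀ x, p x ≠ 0 → ∀ i ≤ B,
      torDim M (ofQuotient (J x)) i j ≤ torDim M (ofQuotient (J x₀)) i j ∧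
        torDim M (ofIdeal (J x)) i j ≤ torDim M (ofIdeal (J x₀)) i j := by
  obtain ⟨F⟩ := GradedFreeResolution.nonempty M
  choose p hp hp0 hple using fun i => h.exists_rank_le_ofQuotient (F.d_graded i) j
  choose q hq hq0 hqle using fun i => h.exists_rank_le_ofIdeal (F.d_graded i) j
  -- One function controls all differentials into F_l with l ≤ B, for quotients and ideals at once.
  -- The bound B keeps this product finite.
  refine ⟨∏ i ∈ Finset.range (B + 1), p i * q i,
    Subalgebra.prod_mem _ fun i _ => Subalgebra.mul_mem _ (hp i) (hq i), ?_, ?_⟩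
  · rw [Finset.prod_apply]
    exact Finset.prod_ne_zero_iff.2 fun i _ => mul_ne_zero (hp0 i) (hq0 i)
  · intro x hx i hi
    rw [Finset.prod_apply, Finset.prod_ne_zero_iff] at hx
    have hx' : ∀ l ≤ i, p l x ≠ 0 ∧ q l x ≠ 0 := fun l hl =>
      mul_ne_zero_iff.1 (hx l (Finset.mem_range.2 (by omega)))
    simp only [torDim_eq F]
    constructor
    · refine seqHomologyRank_le_of_finrank (X := F.strand (ofQuotient (J x)) j)
        (X' := F.strand (ofQuotient (J x₀)) j) _ (F.diff_diff _ j) _ (F.diff_diff _ j) i ?_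
        fun l hl => hple l x (hx' l hl).1
      have h1 := finrank_vecPart_ofQuotient_add (a := F.shift i) (J x) j
      have h2 := finrank_vecPart_ofQuotient_add (a := F.shift i) (J x₀) j
      have h3 := h.finrank_idealVec_eq x (F.shift i) j
      change Module.finrank K ((ofQuotient (J x)).vecPart (F.shift i) j) =
        Module.finrank K ((ofQuotient (J x₀)).vecPart (F.shift i) j)
      omega
    · refine seqHomologyRank_le_of_finrank (X := F.strand (ofIdeal (J x)) j)
        (X' := F.strand (ofIdeal (J x₀)) j) _ (F.diff_diff _ j) _ (F.diff_diff _ j) i ?_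
        fun l hl => hqle l x (hx' l hl).2
      exact ((ofIdealVecEquiv (J x) (F.shift i) j).finrank_eq.trans
        (h.finrank_idealVec_eq x (F.shift i) j)).trans
          (ofIdealVecEquiv (J x₀) (F.shift i) j).finrank_eq.symm

end IsFlatFamily

end FGGradedModule

open FGGradedModule

/-! ### Linear changes of coordinates -/

section CoordChange

variable {K : Type u} [Field K] {n : ℕ}

theorem coordChange_X (g : GL (Fin n) K) (i : Fin n) :
    coordChange g (X i) = ∑ l, C ((g : Matrix (Fin n) (Fin n) K) l i) * X l := by
  rw [coordChange, aeval_X]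

theorem coordChange_mul (g h : GL (Fin n) K) (f : MvPolynomial (Fin n) K) :
    coordChange g (coordChange h f) = coordChange (g * h) f := by
  refine DFunLike.congr_fun (f := (coordChange g).comp (coordChange h)) (algHom_ext fun i => ?_) f
  simp only [AlgHom.comp_apply, coordChange_X, map_sum, map_mul, algHom_C, algebraMap_eq,
    Units.val_mul, Matrix.mul_apply, Finset.mul_sum, Finset.sum_mul]
  rw [Finset.sum_comm]
  refine Finset.sum_congr rfl fun l _ => Finset.sum_congr rfl fun m _ => ?_
  ring

theorem coordChange_one (f : MvPolynomial (Fin n) K) : coordChange 1 f = f := by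
  refine DFunLike.congr_fun (g := AlgHom.id K _) (algHom_ext fun i => ?_) f
  rw [coordChange_X, Finset.sum_eq_single i]
  · simp
  · intro l _ hl
    simp [Matrix.one_apply_ne hl]
  · simp

/-- The change of coordinates as an automorphism. -/
noncomputable def coordChangeEquiv (g : GL (Fin n) K) :
    MvPolynomial (Fin n) K ≃ₐ[K] MvPolynomial (Fin n) K :=
  AlgEquiv.ofAlgHom (coordChange g) (coordChange g⁻¹)
    (AlgHom.ext fun f => by
      rw [AlgHom.comp_apply, coordChange_mul, mul_inv_cancel, coordChange_one, AlgHom.id_apply])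
    (AlgHom.ext fun f => by
      rw [AlgHom.comp_apply, coordChange_mul, inv_mul_cancel, coordChange_one, AlgHom.id_apply])

theorem coordChange_mem_iff (g : GL (Fin n) K) (d : ℤ) (f : MvPolynomial (Fin n) K) :
    coordChange g f ∈ stdGrading K n d ↔ f ∈ stdGrading K n d := by
  refine ⟨fun h => ?_, coordChange_mem g⟩
  have := coordChange_mem g⁻¹ h
  rwa [coordChange_mul, inv_mul_cancel, coordChange_one] at this

theorem changeIdeal_toIdeal (g : GL (Fin n) K) (J : HomogeneousIdeal (stdGrading K n)) :
    (changeIdeal g J).toIdeal =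
      J.toIdeal.map ((coordChangeEquiv g : MvPolynomial (Fin n) K ≃+* MvPolynomial (Fin n) K) :
        MvPolynomial (Fin n) K →+* MvPolynomial (Fin n) K) := rfl

theorem coordChange_mem_changeIdeal (g : GL (Fin n) K) (J : HomogeneousIdeal (stdGrading K n))
    (f : MvPolynomial (Fin n) K) : coordChange g f ∈ (changeIdeal g J).toIdeal ↔
      f ∈ J.toIdeal := by
  rw [changeIdeal_toIdeal]
  refine ⟨fun h => ?_, fun h => Ideal.mem_map_of_mem _ h⟩
  obtain ⟨f', hf', h'⟩ := (Ideal.mem_map_iff_of_surjective _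
    (coordChangeEquiv g).surjective).1 h
  rwa [← (coordChangeEquiv g).injective h']

theorem mem_changeIdeal (g : GL (Fin n) K) (J : HomogeneousIdeal (stdGrading K n))
    (f : MvPolynomial (Fin n) K) :
    f ∈ (changeIdeal g J).toIdeal ↔ coordChange g⁻¹ f ∈ J.toIdeal := by
  rw [← coordChange_mem_changeIdeal g J (coordChange g⁻¹ f), coordChange_mul, mul_inv_cancel,
    coordChange_one]

theorem changeIdeal_mul (g h : GL (Fin n) K) (J : HomogeneousIdeal (stdGrading K n)) :
    changeIdeal g (changeIdeal h J) = changeIdeal (g * h) J := by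
  refine HomogeneousIdeal.toIdeal_injective (Ideal.ext fun f => ?_)
  rw [mem_changeIdeal, mem_changeIdeal, mem_changeIdeal, coordChange_mul, _root_.mul_inv_rev]

theorem idealPart_changeIdeal (g : GL (Fin n) K) (J : HomogeneousIdeal (stdGrading K n)) (d : ℤ) :
    idealPart (changeIdeal g J) d =
      (idealPart J d).map (coordChangeEquiv g).toLinearEquiv.toLinearMap := by
  ext f
  constructor
  · rintro ⟨h1, h2⟩
    exact ⟨coordChange g⁻¹ f, ⟨coordChange_mem _ h1, (mem_changeIdeal g J f).1 h2⟩,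
      (coordChangeEquiv g).apply_symm_apply f⟩
  · rintro ⟨h, ⟨h1, h2⟩, rfl⟩
    exact ⟨coordChange_mem g h1, (coordChange_mem_changeIdeal g J h).2 h2⟩

theorem finrank_idealPart_changeIdeal (g : GL (Fin n) K)
    (J : HomogeneousIdeal (stdGrading K n)) (d : ℤ) :
    Module.finrank K (idealPart (changeIdeal g J) d) = Module.finrank K (idealPart J d) := by
  rw [idealPart_changeIdeal]
  exact LinearEquiv.finrank_map_eq (coordChangeEquiv g).toLinearEquiv _

/-- The change of coordinates on a homogeneous ideal. -/
noncomputable def twistedIsoOfIdeal (g : GL (Fin n) K) (J : HomogeneousIdeal (stdGrading K n)) :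
    TwistedIso (coordChangeEquiv g) (ofIdeal J) (ofIdeal (changeIdeal g J)) where
  equiv :=
    { toFun f := ⟨coordChange g f.1, (coordChange_mem_changeIdeal g J _).2 f.2⟩
      invFun f := ⟨coordChange g⁻¹ f.1, (mem_changeIdeal g J _).1 f.2⟩
      map_add' f h := Subtype.ext (map_add (coordChange g) f.1 h.1)
      map_smul' c f := Subtype.ext (map_smul (coordChange g) c f.1)
      left_inv f := Subtype.ext ((coordChangeEquiv g).symm_apply_apply f.1)
      right_inv f := Subtype.ext ((coordChangeEquiv g).apply_symm_apply f.1) }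
  map_smul s f := Subtype.ext (map_mul (coordChange g) s f.1)
  mem_iff j f := coordChange_mem_iff g j f.1

/-- The change of coordinates on the quotient by a homogeneous ideal. -/
noncomputable def twistedIsoOfQuotient (g : GL (Fin n) K)
    (J : HomogeneousIdeal (stdGrading K n)) :
    TwistedIso (coordChangeEquiv g) (ofQuotient J) (ofQuotient (changeIdeal g J)) where
  equiv := (Ideal.quotientEquivAlg J.toIdeal (changeIdeal g J).toIdeal (coordChangeEquiv g)
    rfl).toLinearEquiv
  map_smul s m := by
    obtain ⟨f, rfl⟩ := Ideal.Quotient.mk_surjective m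
    exact congrArg (Ideal.Quotient.mk (changeIdeal g J).toIdeal) (map_mul (coordChange g) s f)
  mem_iff j m := by
    constructor
    · rintro ⟨f, hf, hfm⟩
      refine ⟨coordChange g⁻¹ f, coordChange_mem _ hf, ?_⟩
      have h : (Ideal.quotientEquivAlg J.toIdeal (changeIdeal g J).toIdeal (coordChangeEquiv g)
          rfl) (Ideal.Quotient.mk _ (coordChange g⁻¹ f)) = Ideal.Quotient.mk _ f :=
        congrArg (Ideal.Quotient.mk (changeIdeal g J).toIdeal)
          ((coordChangeEquiv g).apply_symm_apply f)
      exact AlgEquiv.injective _ (h.trans hfm)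
    · rintro ⟨f, hf, rfl⟩
      exact ⟨coordChange g f, coordChange_mem g hf, rfl⟩

/-- The polynomial functions on `GL_n(K)`. -/
noncomputable def polyFunctionsGL (K : Type u) [Field K] (n : ℕ) :
    Subalgebra K (GL (Fin n) K → K) :=
  (aeval (R := K) fun (q : Fin n × Fin n) (g : GL (Fin n) K) =>
    (g : Matrix (Fin n) (Fin n) K) q.1 q.2).range

theorem mem_polyFunctionsGL {f : GL (Fin n) K → K} :
    f ∈ polyFunctionsGL K n ↔ ∃ p : MvPolynomial (Fin n × Fin n) K, ∀ g : GL (Fin n) K,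
      f g = eval (fun q : Fin n × Fin n => (g : Matrix (Fin n) (Fin n) K) q.1 q.2) p := by
  have key : ∀ (p : MvPolynomial (Fin n × Fin n) K) (g : GL (Fin n) K),
      aeval (R := K) (fun (q : Fin n × Fin n) (g : GL (Fin n) K) =>
        (g : Matrix (Fin n) (Fin n) K) q.1 q.2) p g =
      eval (fun q : Fin n × Fin n => (g : Matrix (Fin n) (Fin n) K) q.1 q.2) p := by
    intro p g
    have h := DFunLike.congr_fun (f := (Pi.evalAlgHom K (fun _ : GL (Fin n) K => K) g).comp
      (aeval (R := K) (fun (q : Fin n × Fin n) (g : GL (Fin n) K) =>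
        (g : Matrix (Fin n) (Fin n) K) q.1 q.2)))
      (g := aeval (R := K) (fun q : Fin n × Fin n => (g : Matrix (Fin n) (Fin n) K) q.1 q.2))
      (algHom_ext fun q => by simp) p
    rw [← coe_aeval_eq_eval]
    exact h
  constructor
  · rintro ⟨p, rfl⟩
    exact ⟨p, fun g => key p g⟩
  · rintro ⟨p, hp⟩
    exact ⟨p, _root_.funext fun g => (key p g).trans (hp g).symm⟩

/-- The coordinates of `g(f)` are polynomial functions of `g`. -/
theorem linear_coordChange_mem (f : MvPolynomial (Fin n) K)
    (φ : MvPolynomial (Fin n) K →ₗ[K] K) :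
    (fun g : GL (Fin n) K => φ (coordChange g f)) ∈ polyFunctionsGL K n := by
  -- Q is the image of f under the generic coordinate change, whose matrix entries are
  -- indeterminates; specializing them to the entries of g gives g(f).
  let Q : MvPolynomial (Fin n) (MvPolynomial (Fin n × Fin n) K) :=
    aeval (R := K) (fun i => ∑ l, C (X (l, i)) * X l) f
  have hQ : ∀ g : GL (Fin n) K, map (eval fun q : Fin n × Fin n =>
      (g : Matrix (Fin n) (Fin n) K) q.1 q.2) Q = coordChange g f := by
    intro g
    have h : (map (eval fun q : Fin n × Fin n =>
        (g : Matrix (Fin n) (Fin n) K) q.1 q.2)).comp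
        (aeval (R := K) (fun i : Fin n => (∑ l, C (X (l, i)) * X l :
          MvPolynomial (Fin n) (MvPolynomial (Fin n × Fin n) K)))).toRingHom =
        (coordChange g).toRingHom := by
      refine ringHom_ext (fun c => ?_) (fun i => ?_)
      · simp
      · simp [coordChange_X]
    exact RingHom.congr_fun h f
  refine mem_polyFunctionsGL.2 ⟨∑ m ∈ Q.support, coeff m Q * C (φ (monomial m 1)), fun g => ?_⟩
  rw [← hQ, map_sum]
  conv_lhs => rw [Q.as_sum, map_sum, map_sum]
  refine Finset.sum_congr rfl fun m _ => ?_
  rw [map_monomial, map_mul, eval_C, ← smul_eq_mul (eval _ _), ← map_smul, smul_monomial,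
    smul_eq_mul, mul_one]

/-- Automorphisms preserve dimensions, and an element f over g₀ moves along as g(g₀⁻¹(f)), whose
coordinates are polynomial in the entries of g. -/
theorem isFlatFamily_changeIdeal (J : HomogeneousIdeal (stdGrading K n)) (g₀ : GL (Fin n) K) :
    IsFlatFamily (polyFunctionsGL K n) (fun g => changeIdeal g J) g₀ where
  finrank_eq g d := by rw [finrank_idealPart_changeIdeal, finrank_idealPart_changeIdeal]
  lift d f hf := by
    refine ⟨fun g => coordChange g (coordChange g₀⁻¹ f), fun g => ?_, ?_,
      fun φ => linear_coordChange_mem _ φ⟩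
    · exact ⟨coordChange_mem _ (coordChange_mem _ hf.1),
        (coordChange_mem_changeIdeal g J _).2 ((mem_changeIdeal g₀ J f).1 hf.2)⟩
    · simp only [coordChange_mul, mul_inv_cancel, coordChange_one]

end CoordChange

/-! ### The degeneration to the initial ideal -/

section Degeneration

variable {K : Type u} [Field K] {n : ℕ}

/-- The polynomials all of whose monomials have weight less than `k`. -/
def weightLT (K : Type u) [Field K] {n : ℕ} (w : Fin n → ℕ) (k : ℕ) :
    Submodule K (MvPolynomial (Fin n) K) where
  carrier := {f | ∀ m, coeff m f ≠ 0 → Finsupp.weight w m < k}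
  zero_mem' m hm := absurd (coeff_zero m) hm
  add_mem' {f g} hf hg m hm := by
    by_cases h : coeff m f = 0
    · exact hg m (by simpa [h] using hm)
    · exact hf m h
  smul_mem' c f hf m hm := hf m fun h => hm (by rw [coeff_smul, h, smul_zero])

/-- The span of the leading parts of the elements of a subspace, for the weight `w`. -/
noncomputable def leadSpan (w : Fin n → ℕ) (W : Submodule K (MvPolynomial (Fin n) K)) :
    Submodule K (MvPolynomial (Fin n) K) :=
  Submodule.span K {f | ∃ k, ∃ h ∈ W, h ∈ weightLT K w (k + 1) ∧
    f = weightedHomogeneousComponent w k h}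

theorem initialForm_mem_leadSpan (w : Fin n → ℕ) {W : Submodule K (MvPolynomial (Fin n) K)}
    {h : MvPolynomial (Fin n) K} (hh : h ∈ W) : initialForm w h ∈ leadSpan w W :=
  Submodule.subset_span ⟨_, h, hh, fun _ hm =>
    Nat.lt_succ_of_le (le_weightedTotalDegree w (mem_support_iff.2 hm)), rfl⟩

theorem component_mem_initialIdeal (w : Fin n → ℕ) (I : HomogeneousIdeal (stdGrading K n))
    {h : MvPolynomial (Fin n) K} (hh : h ∈ I.toIdeal) {k : ℕ} (hk : h ∈ weightLT K w (k + 1)) :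
    weightedHomogeneousComponent w k h ∈ (initialIdeal w I).toIdeal := by
  classical
  have hle : weightedTotalDegree w h ≤ k :=
    Finset.sup_le fun m hm => Nat.lt_succ_iff.1 (hk m (mem_support_iff.1 hm))
  rcases hle.lt_or_eq with hlt | heq
  · rw [weightedHomogeneousComponent_eq_zero _ _ hlt]
    exact zero_mem _
  · rw [← heq]
    exact Ideal.subset_span ⟨h, hh, rfl⟩

/-- Multiplication by a monomial shifts all weights by the same amount, so it carries leading parts
to leading parts. Hence the K-span of leading parts of an ideal is already an ideal. -/
theorem monomial_mul_mem_leadSpan (w : Fin n → ℕ) (I : Ideal (MvPolynomial (Fin n) K))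
    (a : Fin n →₀ ℕ) {f : MvPolynomial (Fin n) K} (hf : f ∈ leadSpan w (I.restrictScalars K)) :
    monomial a 1 * f ∈ leadSpan w (I.restrictScalars K) := by
  classical
  have hle : leadSpan w (I.restrictScalars K) ≤ (leadSpan w (I.restrictScalars K)).comap
      (LinearMap.mulLeft K (monomial a 1)) := by
    refine Submodule.span_le.2 ?_
    rintro _ ⟨k, h, hh, hk, rfl⟩
    refine Submodule.subset_span ⟨Finsupp.weight w a + k, monomial a 1 * h,
      I.mul_mem_left _ hh, fun m hm => ?_, ?_⟩
    · rw [coeff_monomial_mul'] at hm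
      split_ifs at hm with ham
      · have h1 := hk (m - a) (by simpa using hm)
        have h2 : Finsupp.weight w m = Finsupp.weight w a + Finsupp.weight w (m - a) := by
          rw [← map_add, add_tsub_cancel_of_le ham]
        omega
      · exact absurd rfl hm
    · ext m
      rw [LinearMap.mulLeft_apply, coeff_monomial_mul', coeff_weightedHomogeneousComponent,
        coeff_weightedHomogeneousComponent, coeff_monomial_mul']
      by_cases ham : a ≤ m
      · have h2 : Finsupp.weight w m = Finsupp.weight w a + Finsupp.weight w (m - a) := by
          rw [← map_add, add_tsub_cancel_of_le ham]
        simp [ham, h2]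
      · simp [ham]
  exact hle hf

theorem initialIdeal_le_leadSpan (w : Fin n → ℕ) (I : HomogeneousIdeal (stdGrading K n))
    {f : MvPolynomial (Fin n) K} (hf : f ∈ (initialIdeal w I).toIdeal) :
    f ∈ leadSpan w (I.toIdeal.restrictScalars K) := by
  have hf' : f ∈ Ideal.span (initialForm w '' (I.toIdeal : Set (MvPolynomial (Fin n) K))) := hf
  induction hf' using Submodule.span_induction with
  | mem x hx =>
    obtain ⟨h, hh, rfl⟩ := hx
    exact initialForm_mem_leadSpan w (W := I.toIdeal.restrictScalars K) hh
  | zero => exact zero_mem _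
  | add x y hx hy ihx ihy => exact add_mem (ihx hx) (ihy hy)
  | smul s x hx ih =>
    have ihx := ih hx
    rw [smul_eq_mul, s.as_sum, Finset.sum_mul]
    refine Submodule.sum_mem _ fun m _ => ?_
    rw [← mul_one (coeff m s), ← smul_eq_mul (coeff m s), ← smul_monomial, smul_mul_assoc]
    exact Submodule.smul_mem _ _ (monomial_mul_mem_leadSpan w _ m ihx)

/-- Taking components for the standard grading commutes with taking components for w, so leading
parts of I project to leading parts of I_d. Projection may remove the top weight, which is harmless
because `leadSpan` allows any k bounding the weights. -/
theorem idealPart_initialIdeal (w : Fin n → ℕ) (I : HomogeneousIdeal (stdGrading K n)) (d : ℤ) :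
    idealPart (initialIdeal w I) d = leadSpan w (idealPart I d) := by
  classical
  apply le_antisymm
  · rintro f ⟨hd, hf⟩
    have hle : leadSpan w (I.toIdeal.restrictScalars K) ≤
        (leadSpan w (idealPart I d)).comap (stdComponent K n d) := by
      refine Submodule.span_le.2 ?_
      rintro _ ⟨k, h, hh, hk, rfl⟩
      refine Submodule.subset_span ⟨k, stdComponent K n d h,
        ⟨stdComponent_mem d h, stdComponent_mem_ideal I d hh⟩, fun m hm => ?_, ?_⟩
      · rw [stdComponent, coeff_weightedHomogeneousComponent] at hm
        exact hk m fun h0 => hm (by rw [h0, ite_self])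
      · ext m
        simp only [stdComponent, coeff_weightedHomogeneousComponent]
        split_ifs <;> rfl
    have := hle (initialIdeal_le_leadSpan w I hf)
    rwa [Submodule.mem_comap, stdComponent_same hd] at this
  · refine Submodule.span_le.2 ?_
    rintro _ ⟨k, h, hh, hk, rfl⟩
    refine ⟨fun m hm => hh.1 fun h0 => hm ?_, component_mem_initialIdeal w I hh.2 hk⟩
    rw [coeff_weightedHomogeneousComponent, h0, ite_self]

/-- Induction along the weight filtration. The component of weight k has kernel the next smaller
filtration step, and its image on W lies in its image on the leading parts, since those are
themselves homogeneous of weight k. -/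
theorem finrank_inf_weightLT_le (w : Fin n → ℕ) (W : Submodule K (MvPolynomial (Fin n) K))
    [FiniteDimensional K W] [FiniteDimensional K (leadSpan w W)] (k : ℕ) :
    Module.finrank K (W ⊓ weightLT K w k : Submodule K (MvPolynomial (Fin n) K)) ≤
      Module.finrank K (leadSpan w W ⊓ weightLT K w k :
        Submodule K (MvPolynomial (Fin n) K)) := by
  classical
  have hfin : ∀ (V V' : Submodule K (MvPolynomial (Fin n) K)) [FiniteDimensional K V],
      FiniteDimensional K (V ⊓ V' : Submodule K (MvPolynomial (Fin n) K)) :=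
    fun V V' _ => Submodule.finiteDimensional_of_le inf_le_left
  induction k with
  | zero =>
    have : W ⊓ weightLT K w 0 = ⊥ := by
      refine eq_bot_iff.2 fun f hf => ?_
      rw [Submodule.mem_bot]
      ext m
      by_contra h
      exact absurd (hf.2 m h) (Nat.not_lt_zero _)
    rw [this, finrank_bot]
    exact Nat.zero_le _
  | succ k ih =>
    have hker : weightLT K w (k + 1) ⊓ LinearMap.ker (weightedHomogeneousComponent w k) =
        weightLT K w k := by
      ext f
      constructor
      · rintro ⟨h1, h2⟩ m hm
        refine lt_of_le_of_ne (Nat.lt_succ_iff.1 (h1 m hm)) fun hmk => hm ?_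
        have := congrArg (coeff m) (LinearMap.mem_ker.1 h2)
        rwa [coeff_weightedHomogeneousComponent, if_pos hmk, coeff_zero] at this
      · intro h
        refine ⟨fun m hm => (h m hm).trans k.lt_succ_self, ?_⟩
        refine LinearMap.mem_ker.2 ?_
        ext m
        rw [coeff_weightedHomogeneousComponent, coeff_zero]
        split_ifs with hmk
        · by_contra h0
          exact absurd hmk (h m h0).ne
        · rfl
    have h1 := finrank_map_add_finrank_inf_ker (weightedHomogeneousComponent w k)
      (W ⊓ weightLT K w (k + 1))
    have h2 := finrank_map_add_finrank_inf_ker (weightedHomogeneousComponent w k)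
      (leadSpan w W ⊓ weightLT K w (k + 1))
    rw [inf_assoc, hker] at h1 h2
    have h3 : (W ⊓ weightLT K w (k + 1)).map (weightedHomogeneousComponent w k) ≤
        (leadSpan w W ⊓ weightLT K w (k + 1)).map (weightedHomogeneousComponent w k) := by
      rintro _ ⟨h, ⟨hW, hk⟩, rfl⟩
      refine ⟨weightedHomogeneousComponent w k h,
        ⟨Submodule.subset_span ⟨k, h, hW, hk, rfl⟩, fun m hm => ?_⟩, ?_⟩
      · rw [coeff_weightedHomogeneousComponent] at hm
        split_ifs at hm with hmk
        · omega
        · exact absurd rfl hm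
      · ext m
        simp only [coeff_weightedHomogeneousComponent]
        split_ifs <;> rfl
    have : FiniteDimensional K ((leadSpan w W ⊓ weightLT K w (k + 1)).map
      (weightedHomogeneousComponent w k)) := Module.Finite.map _ _
    have h4 := Submodule.finrank_mono h3
    omega

theorem finrank_idealPart_le_initialIdeal (w : Fin n → ℕ)
    (I : HomogeneousIdeal (stdGrading K n)) (d : ℤ) :
    Module.finrank K (idealPart I d) ≤ Module.finrank K (idealPart (initialIdeal w I) d) := by
  have hfin : FiniteDimensional K (leadSpan w (idealPart I d)) := by
    rw [← idealPart_initialIdeal]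
    infer_instance
  -- A monomial of degree d has weight at most (∑ w_i)·d, so at this step the filtration contains
  -- all of S_d.
  have hle : stdGrading K n d ≤ weightLT K w ((∑ i, w i) * d.toNat + 1) := by
    intro f hf m hm
    have hd := mem_stdGrading.1 hf m hm
    have h1 : Finsupp.weight w m ≤ (∑ i, w i) * m.degree := by
      rw [Finsupp.weight_apply, Finsupp.sum_fintype _ _ (by simp), Finset.sum_mul]
      refine Finset.sum_le_sum fun i _ => ?_
      rw [smul_eq_mul, mul_comm]
      exact Nat.mul_le_mul_left _ (Finsupp.le_degree i m)
    have h2 : m.degree = d.toNat := by omega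
    rw [h2] at h1
    exact Nat.lt_succ_of_le h1
  have h := finrank_inf_weightLT_le w (idealPart I d) ((∑ i, w i) * d.toNat + 1)
  have hle' : ∀ I' : HomogeneousIdeal (stdGrading K n),
      idealPart I' d ⊓ weightLT K w ((∑ i, w i) * d.toNat + 1) = idealPart I' d :=
    fun I' => inf_eq_left.2 (inf_le_left.trans hle)
  rwa [← idealPart_initialIdeal, hle', hle'] at h

/-! ### The torus family and its limit -/

/-- The diagonal matrix with entries `u ^ w i`. -/
noncomputable def torusGL (w : Fin n → ℕ) (u : Kˣ) : GL (Fin n) K where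
  val := Matrix.diagonal fun i => ((u ^ w i : Kˣ) : K)
  inv := Matrix.diagonal fun i => (((u ^ w i)⁻¹ : Kˣ) : K)
  val_inv := by simp [Matrix.diagonal_mul_diagonal]
  inv_val := by simp [Matrix.diagonal_mul_diagonal]

theorem coordChange_torusGL_monomial (w : Fin n → ℕ) (u : Kˣ) (m : Fin n →₀ ℕ) (c : K) :
    coordChange (torusGL w u) (monomial m c) =
      monomial m (c * (u : K) ^ Finsupp.weight w m) := by
  have hX : ∀ i, coordChange (torusGL w u) (X i) = C ((u : K) ^ w i) * X i := by
    intro i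
    rw [coordChange_X, Finset.sum_eq_single i]
    · simp [torusGL]
    · intro l _ hl
      simp [torusGL, Matrix.diagonal_apply_ne _ hl]
    · simp
  have hw : Finsupp.weight w m = ∑ i, w i * m i := by
    rw [Finsupp.weight_apply, Finsupp.sum_fintype _ _ (by simp)]
    exact Finset.sum_congr rfl fun i _ => by rw [smul_eq_mul, mul_comm]
  rw [monomial_eq, monomial_eq, map_mul, algHom_C, algebraMap_eq, C_mul, mul_assoc]
  congr 1
  rw [Finsupp.prod_fintype _ _ (by simp), map_prod, hw, ← Finset.prod_pow_eq_pow_sum, map_prod,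
    ← Finset.prod_mul_distrib]
  refine Finset.prod_congr rfl fun i _ => ?_
  rw [map_pow, hX, mul_pow, pow_mul, C_pow (_ ^ _)]

/-- The family of ideals degenerating to the initial ideal at `t = 0`. -/
noncomputable def degeneration (w : Fin n → ℕ) (I : HomogeneousIdeal (stdGrading K n)) (t : K) :
    HomogeneousIdeal (stdGrading K n) :=
  open Classical in
  if h : t = 0 then initialIdeal w I else changeIdeal (torusGL w (Units.mk0 t h)⁻¹) I

theorem degeneration_zero (w : Fin n → ℕ) (I : HomogeneousIdeal (stdGrading K n)) :
    degeneration w I 0 = initialIdeal w I :=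
  dif_pos rfl

theorem degeneration_of_ne (w : Fin n → ℕ) (I : HomogeneousIdeal (stdGrading K n)) {t : K}
    (h : t ≠ 0) : degeneration w I t = changeIdeal (torusGL w (Units.mk0 t h)⁻¹) I :=
  dif_neg h

/-- The polynomial functions on `K`. -/
noncomputable def polyFunctions (K : Type u) [Field K] : Subalgebra K (K → K) :=
  (Polynomial.aeval (R := K) (id : K → K)).range

theorem exists_ne_zero_of_polyFunctions [Infinite K] {p : K → K} (hp : p ∈ polyFunctions K)
    (h0 : p 0 ≠ 0) : ∃ t, t ≠ 0 ∧ p t ≠ 0 := by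
  obtain ⟨q, rfl⟩ := hp
  have key : ∀ t, Polynomial.aeval (R := K) (id : K → K) q t = q.eval t := by
    intro t
    have h := DFunLike.congr_fun (f := (Pi.evalAlgHom K (fun _ : K => K) t).comp
      (Polynomial.aeval (R := K) (id : K → K))) (g := Polynomial.aeval t)
      (Polynomial.algHom_ext (by simp)) q
    rw [← Polynomial.coe_aeval_eq_eval]
    exact h
  by_contra! hall
  -- The factor X covers the point 0, where q is not assumed to vanish; over an infinite field a
  -- polynomial vanishing everywhere is zero.
  have hX : Polynomial.X * q = 0 := by
    refine Polynomial.funext fun t => ?_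
    rw [Polynomial.eval_mul, Polynomial.eval_X, Polynomial.eval_zero]
    by_cases ht : t = 0
    · rw [ht, zero_mul]
    · rw [← key]
      exact mul_eq_zero_of_right _ (hall t ht)
  have hq : q = 0 := (mul_eq_zero.1 hX).resolve_left Polynomial.X_ne_zero
  exact h0 (by rw [hq, map_zero]; rfl)

theorem pow_mem_polyFunctions (k : ℕ) : (fun t : K => t ^ k) ∈ polyFunctions K :=
  ⟨Polynomial.X ^ k, by
    funext t
    simp⟩

/-- If h ∈ I_d has weights at most k, then t^k times the torus translate of h by t⁻¹ scales a term
of weight v by t^(k - v). This is polynomial in t, lies in the translated ideal for t ≠ 0, and at t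
= 0 is the component of weight k. Such components span the initial ideal in degree d. -/
theorem lift_degeneration (w : Fin n → ℕ) (I : HomogeneousIdeal (stdGrading K n)) (d : ℤ)
    {f : MvPolynomial (Fin n) K} (hf : f ∈ idealPart (initialIdeal w I) d) :
    ∃ F : K → MvPolynomial (Fin n) K, (∀ t, F t ∈ idealPart (degeneration w I t) d) ∧ F 0 = f ∧
      ∀ φ : MvPolynomial (Fin n) K →ₗ[K] K, (fun t => φ (F t)) ∈ polyFunctions K := by
  classical
  rw [idealPart_initialIdeal] at hf
  induction hf using Submodule.span_induction with
  | zero => exact ⟨fun _ => 0, fun t => zero_mem _, rfl, fun φ => by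
      simp only [map_zero]
      exact Subalgebra.zero_mem _⟩
  | add x y _ _ ihx ihy =>
    obtain ⟨F, h1, rfl, h3⟩ := ihx
    obtain ⟨G, k1, rfl, k3⟩ := ihy
    refine ⟨fun t => F t + G t, fun t => add_mem (h1 t) (k1 t), rfl, fun φ => ?_⟩
    simp only [map_add]
    exact Subalgebra.add_mem _ (h3 φ) (k3 φ)
  | smul c _ _ ih =>
    obtain ⟨F, h1, rfl, h3⟩ := ih
    refine ⟨fun t => c • F t, fun t => Submodule.smul_mem _ c (h1 t), rfl, fun φ => ?_⟩
    simp only [map_smul]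
    exact Subalgebra.smul_mem _ (h3 φ) c
  | mem x hx =>
    obtain ⟨k, h, hh, hk, rfl⟩ := hx
    -- At t = 0 the factor 0 ^ 0 = 1 keeps exactly the terms of weight k. The subtraction is not
    -- truncated, as `hk` bounds all weights by k.
    have h0 : ∑ m ∈ h.support, monomial m (coeff m h * 0 ^ (k - Finsupp.weight w m)) =
        weightedHomogeneousComponent w k h := by
      rw [weightedHomogeneousComponent_apply, Finset.sum_filter]
      refine Finset.sum_congr rfl fun m hm => ?_
      have := hk m (mem_support_iff.1 hm)
      split_ifs with hmk
      · rw [hmk, Nat.sub_self, pow_zero, mul_one]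
      · rw [zero_pow (by omega), mul_zero, monomial_zero]
    refine ⟨fun t => ∑ m ∈ h.support, monomial m (coeff m h * t ^ (k - Finsupp.weight w m)),
      fun t => ?_, h0, fun φ => ?_⟩
    · by_cases ht : t = 0
      · subst ht
        simp only [h0]
        rw [degeneration_zero, idealPart_initialIdeal]
        exact Submodule.subset_span ⟨k, h, hh, hk, rfl⟩
      · have hF : ∑ m ∈ h.support, monomial m (coeff m h * t ^ (k - Finsupp.weight w m)) =
            t ^ k • coordChange (torusGL w (Units.mk0 t ht)⁻¹) h := by
          conv_rhs => rw [h.as_sum, map_sum, Finset.smul_sum]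
          refine Finset.sum_congr rfl fun m hm => ?_
          have := hk m (mem_support_iff.1 hm)
          rw [coordChange_torusGL_monomial, smul_monomial, smul_eq_mul, mul_left_comm,
            Units.val_inv_eq_inv_val, Units.val_mk0, inv_pow,
            pow_sub₀ t ht (Nat.lt_succ_iff.1 this)]
        simp only [hF]
        rw [degeneration_of_ne w I ht]
        exact Submodule.smul_mem _ _ ⟨coordChange_mem _ hh.1,
          (coordChange_mem_changeIdeal _ I h).2 hh.2⟩
    · have : (fun t : K => φ (∑ m ∈ h.support,
          monomial m (coeff m h * t ^ (k - Finsupp.weight w m)))) =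
          ∑ m ∈ h.support, (coeff m h * φ (monomial m 1)) •
            fun t : K => t ^ (k - Finsupp.weight w m) := by
        funext t
        rw [Finset.sum_apply, map_sum]
        refine Finset.sum_congr rfl fun m _ => ?_
        rw [← mul_one (coeff m h * t ^ _), ← smul_eq_mul (coeff m h * t ^ _), ← smul_monomial,
          map_smul, Pi.smul_apply, smul_eq_mul, smul_eq_mul]
        ring
      rw [this]
      exact Subalgebra.sum_mem _ fun m _ => Subalgebra.smul_mem _ (pow_mem_polyFunctions _) _

/-- The weight filtration gives dim I_d ≤ dim in_w(I)_d. Conversely, the lifts give dim in_w(I)_d ≤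
dim of a translate of I_d at some t ≠ 0, which exists because K is infinite, and translates all have
the dimension of I_d. -/
theorem isFlatFamily_degeneration [Infinite K] (w : Fin n → ℕ)
    (I : HomogeneousIdeal (stdGrading K n)) :
    IsFlatFamily (polyFunctions K) (degeneration w I) 0 where
  lift d f hf := lift_degeneration w I d (by rwa [degeneration_zero] at hf)
  finrank_eq t d := by
    by_cases ht : t = 0
    · rw [ht]
    · rw [degeneration_of_ne w I ht, finrank_idealPart_changeIdeal, degeneration_zero]
      refine le_antisymm (finrank_idealPart_le_initialIdeal w I d) ?_
      obtain ⟨p, hp, h0, hle⟩ := exists_finrank_le_of_lift (polyFunctions K)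
        (fun t => idealPart (degeneration w I t) d) 0
        (fun f hf => lift_degeneration w I d (by rwa [degeneration_zero] at hf))
      obtain ⟨s, hs, hps⟩ := exists_ne_zero_of_polyFunctions hp h0
      have := hle s hps
      rwa [degeneration_zero, degeneration_of_ne w I hs, finrank_idealPart_changeIdeal] at this

/-- For a suitable coordinate change, `Tor` does not exceed `Tor` against the initial ideal. -/
theorem exists_torusGL_torDim_le [Infinite K] (w : Fin n → ℕ)
    (I : HomogeneousIdeal (stdGrading K n)) (M M' : FGGradedModule K n) (j : ℤ) (B : ℕ) :
    ∃ g : GL (Fin n) K, ∀ i ≤ B,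
      torDim M (ofQuotient (changeIdeal g I)) i j ≤
          torDim M (ofQuotient (initialIdeal w I)) i j ∧
        torDim M (ofIdeal (changeIdeal g I)) i j ≤ torDim M (ofIdeal (initialIdeal w I)) i j ∧
        torDim M' (ofQuotient (changeIdeal g I)) i j ≤
          torDim M' (ofQuotient (initialIdeal w I)) i j := by
  obtain ⟨p, hp, hp0, hple⟩ := (isFlatFamily_degeneration w I).exists_torDim_le M j B
  obtain ⟨q, hq, hq0, hqle⟩ := (isFlatFamily_degeneration w I).exists_torDim_le M' j B
  -- Taking the product makes a single t, hence a single coordinate change, serve both M and M'.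
  obtain ⟨t, ht, hpq⟩ := exists_ne_zero_of_polyFunctions (Subalgebra.mul_mem _ hp hq)
    (mul_ne_zero hp0 hq0)
  obtain ⟨hpt, hqt⟩ := mul_ne_zero_iff.1 hpq
  refine ⟨torusGL w (Units.mk0 t ht)⁻¹, fun i hi => ?_⟩
  have h1 := hple t hpt i hi
  have h2 := hqle t hqt i hi
  rw [degeneration_zero, degeneration_of_ne w I ht] at h1 h2
  exact ⟨h1.1, h1.2, h2.1⟩

theorem part_ofIdeal_eq_bot (I : HomogeneousIdeal (stdGrading K n)) (d : ℤ) (hd : d < 0) :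
    (ofIdeal I).part d = ⊥ :=
  eq_bot_iff.2 fun _ hx => Subtype.ext (eq_zero_of_mem_stdGrading_neg hd hx)

theorem part_ofQuotient_eq_bot (I : HomogeneousIdeal (stdGrading K n)) (d : ℤ) (hd : d < 0) :
    (ofQuotient I).part d = ⊥ := by
  refine eq_bot_iff.2 ?_
  rintro _ ⟨f, hf, rfl⟩
  rw [eq_zero_of_mem_stdGrading_neg hd hf, map_zero]
  exact zero_mem _

end Degeneration

/-! ### The inequalities for general coordinates -/

theorem proposition2p3 {K : Type u} [Field K] [Infinite K] (n : ℕ)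
    (I J : HomogeneousIdeal (stdGrading K n)) (w w' : Fin n → ℕ) (j : ℤ) :
    ForGeneralGL fun g : GL (Fin n) K => ∀ i : ℕ,
      torDim (FGGradedModule.ofQuotient I) (FGGradedModule.ofQuotient (changeIdeal g J)) i j ≤
          torDim (FGGradedModule.ofQuotient (initialIdeal w I))
            (FGGradedModule.ofQuotient (initialIdeal w' J)) i j ∧
        torDim (FGGradedModule.ofIdeal I) (FGGradedModule.ofQuotient (changeIdeal g J)) i j ≤
          torDim (FGGradedModule.ofIdeal (initialIdeal w I))
            (FGGradedModule.ofQuotient (initialIdeal w' J)) i j := by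
  -- The second argument is moved first, against both S/in_w(I) and in_w(I), so that one h serves
  -- (i) and (ii). The first argument is then moved against the fixed module S/h(J). The bound
  -- `j.toNat` covers every i that can contribute.
  obtain ⟨h, hh⟩ := exists_torusGL_torDim_le w' J (ofQuotient (initialIdeal w I))
    (ofIdeal (initialIdeal w I)) j j.toNat
  obtain ⟨h', hh'⟩ := exists_torusGL_torDim_le w I (ofQuotient (changeIdeal h J))
    (ofQuotient (changeIdeal h J)) j j.toNat
  -- Undoing h' on both arguments turns the pair (h'(I), h(J)) into (I, g₀(J)).
  let g₀ : GL (Fin n) K := h'⁻¹ * h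
  have hg₀ : changeIdeal h' (changeIdeal g₀ J) = changeIdeal h J := by
    rw [changeIdeal_mul, mul_inv_cancel_left]
  have hσ := coordChange_mem_iff h'
  have hQ : ∀ i ≤ j.toNat, torDim (ofQuotient I) (ofQuotient (changeIdeal g₀ J)) i j ≤
      torDim (ofQuotient (initialIdeal w I)) (ofQuotient (initialIdeal w' J)) i j := by
    intro i hi
    rw [torDim_twist hσ (twistedIsoOfQuotient h' I) (twistedIsoOfQuotient h' _), hg₀, torDim_comm]
    refine ((hh' i hi).1.trans ?_)
    rw [torDim_comm]
    exact (hh i hi).1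
  have hI : ∀ i ≤ j.toNat, torDim (ofIdeal I) (ofQuotient (changeIdeal g₀ J)) i j ≤
      torDim (ofIdeal (initialIdeal w I)) (ofQuotient (initialIdeal w' J)) i j := by
    intro i hi
    rw [torDim_twist hσ (twistedIsoOfIdeal h' I) (twistedIsoOfQuotient h' _), hg₀, torDim_comm]
    refine ((hh' i hi).2.1.trans ?_)
    rw [torDim_comm]
    exact (hh i hi).2.2
  -- The inequalities hold at g₀; semicontinuity in g extends them to where p and q do not vanish.
  -- This set contains g₀, and its complement is cut out by the single polynomial f representing pq.
  obtain ⟨p, hp, hp0, hple⟩ := (isFlatFamily_changeIdeal J g₀).exists_torDim_le (ofQuotient I) j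
    j.toNat
  obtain ⟨q, hq, hq0, hqle⟩ := (isFlatFamily_changeIdeal J g₀).exists_torDim_le (ofIdeal I) j
    j.toNat
  obtain ⟨f, hf⟩ := mem_polyFunctionsGL.1 (Subalgebra.mul_mem _ hp hq)
  refine ⟨{g | p g * q g ≠ 0}, ⟨g₀, mul_ne_zero hp0 hq0⟩, ⟨{f}, ?_⟩, ?_⟩
  · ext g
    have := hf g
    rw [Pi.mul_apply] at this
    rw [Set.mem_compl_iff, Set.mem_ofPred_eq, not_not, this]
    simp
  · intro g hg i
    obtain ⟨hpg, hqg⟩ := mul_ne_zero_iff.1 hg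
    rcases le_or_gt i j.toNat with hi | hi
    · exact ⟨(hple g hpg i hi).1.trans (hQ i hi), (hqle g hqg i hi).1.trans (hI i hi)⟩
    · have hij : j < i := by omega
      rw [torDim_eq_zero (part_ofQuotient_eq_bot I) (part_ofQuotient_eq_bot _) hij,
        torDim_eq_zero (part_ofIdeal_eq_bot I) (part_ofQuotient_eq_bot _) hij]
      exact ⟨zero_le, zero_le⟩
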